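/- **Theorem (reproducing formula on Minkowski space).** Let $\mathbb H_{\mathbb C}$ be the algebra of complex $2\times2$ matrices $Z=(z_{ij})$, let $N(Z)=\det Z$, and let $Z^*$ be the conjugate transpose of $Z$. Put $$\mathbb M=\{Z\in\mathbb H_{\mathbb C}: Z^*=-Z\},\qquad C^+=\{Y\in\mathbb M: N(Y)<0,\ i\operatorname{Tr}Y<0\},\qquad \mathbb T^\pm=\mathbb M\pm iC^+,$$ $$\mathbb D^+=\{Z: ZZ^*<1\},\qquad \mathbb D^-=\{Z: ZZ^*>1\}.$$ For $h=\begin{pmatrix}a'&b'\\c'&d'\end{pmatrix}\in GL(2,\mathbb H_{\mathbb C})$ with $h^{-1}=\begin{pmatrix}a&b\\c&d\end{pmatrix}$ let $$(\rho_1(h)F)(Z)=\frac{F\bigl((aZ+b)(cZ+d)^{-1}\bigr)}{N(cZ+d)\,N(a'-Zc')},\qquad\text{and let}\quad \gamma=\begin{pmatrix}i&1\\i&-1\end{pmatrix}.$$ Let $\mathrm{Zh}(\mathbb M)^+$ be the space of holomorphic functions $F$ on $\mathbb T^+$ such that $\rho_1(\gamma^{-1})F$, which is defined on $\mathbb D^+$,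 extends to a holomorphic function on a neighborhood of the closure of $\mathbb D^+$. Let $\mathrm{Zh}(\mathbb M)^-$ be the space of holomorphic functions $F$ on $\mathbb T^-$ such that $\rho_1(\gamma^{-1})F$, which is defined on $\mathbb D^-$, extends to a holomorphic function $G$ on a neighborhood of the closure of $\mathbb D^-$ that is regular at infinity, i.e. $\bigl(\rho_1\begin{pmatrix}0&1\\1&0\end{pmatrix}G\bigr)(Z)=N(Z)^{-2}\,G(Z^{-1})$, defined for invertible $Z$ near $0$, extends holomorphically to a neighborhood of $0$. The values of $F\in\mathrm{Zh}(\mathbb M)^\pm$ on $\mathbb M$ are its boundary values, i.e. its limits from within $\mathbb T^\pm$. Let $dZ^4=dz_{11}\wedge dz_{12}\wedge dz_{21}\wedge dz_{22}$, and orient $\mathbb M$ by its basis $$\tilde e_0=\begin{pmatrix}-i&0\\0&-i\end{pmatrix},\quad e_1=\begin{pmatrix}0&-i\\-i&0\end{pmatrix},\quad e_2=\begin{pmatrix}0&-1\\1&0\end{pmatrix},\quad e_3=\begin{pmatrix}-i&0\\0&i\end{pmatrix}.$$ Write $\langle F_1,F_2\rangle_1=\frac{i}{8\pi^3}\int_{\mathbb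 M}F_1(Z)F_2(Z)\,dZ^4$. Then for all $F\in\mathrm{Zh}(\mathbb M)^+$ and all $W\in\mathbb T^+$ the boundary values of $F$ exist at every point of $\mathbb M$, the integral below converges absolutely, and $$F(W)=\Bigl\langle F(Z),\frac1{N(Z-W)^2}\Bigr\rangle_1=\frac{i}{8\pi^3}\int_{Z\in\mathbb M}\frac{F(Z)}{N(Z-W)^2}\,dZ^4 .$$ Similarly, for all $F\in\mathrm{Zh}(\mathbb M)^-$ and all $W\in\mathbb T^-$ the boundary values of $F$ exist at every point of $\mathbb M$, the integral converges absolutely, and the same formula holds. -/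

import Mathlib

open scoped Matrix ComplexOrder

noncomputable section

/-- The algebra `ℍ_ℂ` of complexified quaternions, realized as the complex `2 × 2` matrices, with
its usual topology. -/
abbrev HC : Type := Matrix (Fin 2) (Fin 2) ℂ

namespace HC

open Complex Topology MeasureTheory Filter

/-- The quadratic norm `N(Z) = z₁₁ z₂₂ - z₁₂ z₂₁`. -/
def N (Z : HC) : ℂ := Z.det

/-! ### Minkowski space, tube domains, bounded domains -/

/-- Minkowski space `𝕄 = {Z ; Z* = -Z}`. -/
def minkowski : Set HC := {Z | Zᴴ = -Z}

/-- The open cone `C⁺ = {Y ∈ 𝕄 ; N(Y) < 0, i Tr Y < 0}`; both numbers are real for `Y ∈ 𝕄`. -/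
def cone : Set HC := {Y | Y ∈ minkowski ∧ (N Y).re < 0 ∧ (I * Y.trace).re < 0}

/-- The tube domain `𝕋⁺ = 𝕄 + i C⁺`. -/
def tubePlus : Set HC := {Z | ∃ X ∈ minkowski, ∃ Y ∈ cone, Z = X + I • Y}

/-- The tube domain `𝕋⁻ = 𝕄 - i C⁺`. -/
def tubeMinus : Set HC := {Z | ∃ X ∈ minkowski, ∃ Y ∈ cone, Z = X - I • Y}

/-- The bounded domain `𝔻⁺ = {Z ; Z Z* < 1}`. -/
def discPlus : Set HC := {Z | (1 - Z * Zᴴ).PosDef}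

/-- The domain `𝔻⁻ = {Z ; Z Z* > 1}`. -/
def discMinus : Set HC := {Z | (Z * Zᴴ - 1).PosDef}

/-! ### The action `ρ₁` -/

/-- `GL(2, ℍ_ℂ)`: the invertible `2 × 2` matrices with entries in `ℍ_ℂ`. -/
abbrev GL2 : Type := (Matrix (Fin 2) (Fin 2) HC)ˣ

/-- The action `ρ₁(h) : F(Z) ↦ F((aZ+b)(cZ+d)⁻¹) / (N(cZ+d) N(a'-Zc'))`, where
`h = (a' b'; c' d')` and `h⁻¹ = (a b; c d)`. -/
def rho1 (h : GL2) (F : HC → ℂ) (Z : HC) : ℂ :=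
  let a : HC := (h⁻¹).val 0 0
  let b : HC := (h⁻¹).val 0 1
  let c : HC := (h⁻¹).val 1 0
  let d : HC := (h⁻¹).val 1 1
  let a' : HC := h.val 0 0
  let c' : HC := h.val 1 0
  F ((a * Z + b) * (c * Z + d)⁻¹) / (N (c * Z + d) * N (a' - Z * c'))

/-- The element `γ = (i 1; i -1)` of `GL(2, ℍ_ℂ)`, which gives the Cayley transform. -/
def cayley : GL2 where
  val := !![I • (1 : HC), 1; I • (1 : HC), -1]
  inv := !![(-I / 2) • (1 : HC), (-I / 2) • (1 : HC);
            (1 / 2 : ℂ) • (1 : HC), (-1 / 2 : ℂ) • (1 : HC)]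
  val_inv := by
    ext i j k l
    fin_cases i <;> fin_cases j <;> fin_cases k <;> fin_cases l <;>
      simp [Matrix.mul_apply, Fin.sum_univ_two] <;> ring_nf <;> simp
    all_goals norm_num
  inv_val := by
    ext i j k l
    fin_cases i <;> fin_cases j <;> fin_cases k <;> fin_cases l <;>
      simp [Matrix.mul_apply, Fin.sum_univ_two] <;> ring_nf <;> simp

/-- The element `(0 1; 1 0)` of `GL(2, ℍ_ℂ)`, which acts by the inversion `Z ↦ Z⁻¹`. -/
def inversion : GL2 where
  val := !![0, 1; 1, 0]
  inv := !![0, 1; 1, 0]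
  val_inv := by simp [Matrix.one_fin_two]
  inv_val := by simp [Matrix.one_fin_two]

theorem rho1_inversion (F : HC → ℂ) (Z : HC) : rho1 inversion F Z = F Z⁻¹ / N Z ^ 2 := by
  have h : (-Z).det = Z.det := by simp [Matrix.det_neg]
  simp [rho1, inversion, N, h, sq]

theorem rho1_cayley_inv (F : HC → ℂ) (Z : HC) :
    rho1 cayley⁻¹ F Z =
      -4 * F ((Z - I • (1 : HC)) * (Z + I • (1 : HC))⁻¹) / N (Z + I • (1 : HC)) ^ 2 := by
  have h1 : I • Z + 1 = I • (Z - I • (1 : HC)) := by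
    rw [smul_sub, smul_smul]; simp
  have h2 : I • Z + -1 = I • (Z + I • (1 : HC)) := by
    rw [smul_add, smul_smul]; simp
  have h3 : (-I / 2) • (1 : HC) - Z * ((1 / 2 : ℂ) • (1 : HC)) =
      (-1 / 2 : ℂ) • (Z + I • (1 : HC)) := by
    rw [smul_add, smul_smul, mul_smul_comm, mul_one]; module
  have h4 : (I • (Z - I • (1 : HC))) * (I • (Z + I • (1 : HC)))⁻¹ =
      (Z - I • (1 : HC)) * (Z + I • (1 : HC))⁻¹ := by
    have e : (I • (Z + I • (1 : HC)))⁻¹ = (-I) • (Z + I • (1 : HC))⁻¹ := by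
      by_cases h : IsUnit (Z + I • (1 : HC)).det
      · apply Matrix.inv_eq_right_inv
        rw [smul_mul_smul_comm, Matrix.mul_nonsing_inv _ h]
        simp
      · rw [Matrix.nonsing_inv_apply_not_isUnit _ h, Matrix.nonsing_inv_apply_not_isUnit, smul_zero]
        simpa only [Matrix.det_smul, Fintype.card_fin, I_sq, neg_one_mul, IsUnit.neg_iff] using h
    rw [e, smul_mul_smul_comm]
    simp
  simp only [rho1, cayley, Units.inv_mk, Matrix.of_apply, Matrix.cons_val_zero,
    Matrix.cons_val_one, Matrix.cons_val', Matrix.cons_val_fin_one, smul_mul_assoc, one_mul]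
  rw [h1, h2, h3, h4]
  simp only [N, Matrix.det_smul, Fintype.card_fin, I_sq]
  by_cases h : (Z + I • (1 : HC)).det = 0
  · simp [h]
  · field_simp
    ring

/-! ### The function spaces -/

/-- `G` is regular at infinity if `(ρ₁(0 1; 1 0) G)(Z) = G(Z⁻¹) / N(Z)²`, which makes sense for
invertible `Z` near the origin, extends holomorphically to a neighborhood of the origin. -/
def RegularAtInfinity (G : HC → ℂ) : Prop :=
  ∃ V : Set HC, IsOpen V ∧ (0 : HC) ∈ V ∧ ∃ H : HC → ℂ, DifferentiableOn ℂ H V ∧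
    ∀ Z ∈ V, IsUnit Z → H Z = rho1 inversion G Z

/-- `Zh(𝕄)⁺`: holomorphic functions `F` on `𝕋⁺` such that `ρ₁(γ⁻¹) F` (a function on `𝔻⁺`, which
`Z ↦ (Z - i) (Z + i)⁻¹` maps into `𝕋⁺`) extends holomorphically to a neighborhood of the closure
of `𝔻⁺`. Only the values of `F` on `𝕋⁺` matter. -/
def ZhPlus : Set (HC → ℂ) :=
  {F | DifferentiableOn ℂ F tubePlus ∧
    ∃ U : Set HC, IsOpen U ∧ closure discPlus ⊆ U ∧
      ∃ G : HC → ℂ, DifferentiableOn ℂ G U ∧ Set.EqOn G (rho1 cayley⁻¹ F) discPlus}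

/-- `Zh(𝕄)⁻`: holomorphic functions `F` on `𝕋⁻` such that `ρ₁(γ⁻¹) F` (a function on `𝔻⁻`, which
`Z ↦ (Z - i) (Z + i)⁻¹` maps into `𝕋⁻`) extends to a holomorphic function defined on a neighborhood
of the closure of `𝔻⁻` and regular at infinity. Only the values of `F` on `𝕋⁻` matter. -/
def ZhMinus : Set (HC → ℂ) :=
  {F | DifferentiableOn ℂ F tubeMinus ∧
    ∃ U : Set HC, IsOpen U ∧ closure discMinus ⊆ U ∧
      ∃ G : HC → ℂ, DifferentiableOn ℂ G U ∧ Set.EqOn G (rho1 cayley⁻¹ F) discMinus ∧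
        RegularAtInfinity G}

/-! ### Integration over Minkowski space -/

/-- The positively oriented real basis `ẽ₀, e₁, e₂, e₃` of `𝕄`. -/
def basis : Fin 4 → HC :=
  ![!![-I, 0; 0, -I], !![0, -I; -I, 0], !![0, -1; 1, 0], !![-I, 0; 0, I]]

/-- The point `y⁰ ẽ₀ + y¹ e₁ + y² e₂ + y³ e₃` of `𝕄`. -/
def point (y : Fin 4 → ℝ) : HC := ∑ k, (y k : ℂ) • basis k

/-- `point` parametrizes exactly Minkowski space. -/
theorem range_point : Set.range point = minkowski := by
  ext Z
  constructor
  · rintro ⟨y, rfl⟩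
    show _ᴴ = _
    ext i j
    fin_cases i <;> fin_cases j <;>
      simp [point, basis, Fin.sum_univ_four] <;> ring
  · intro (h : Zᴴ = -Z)
    have h00 := congrFun (congrFun h 0) 0
    have h01 := congrFun (congrFun h 0) 1
    have h11 := congrFun (congrFun h 1) 1
    simp only [Matrix.conjTranspose_apply, Matrix.neg_apply, Complex.ext_iff, RCLike.star_def,
      conj_re, conj_im, neg_re, neg_im] at h00 h01 h11
    refine ⟨![-((Z 0 0).im + (Z 1 1).im) / 2, -(Z 0 1).im, -(Z 0 1).re,
      ((Z 1 1).im - (Z 0 0).im) / 2], ?_⟩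
    ext i j
    fin_cases i <;> fin_cases j <;> apply Complex.ext <;>
      simp [point, basis, Fin.sum_univ_four] <;> linarith

/-- The holomorphic 4-form `dZ⁴ = dz₁₁ ∧ dz₁₂ ∧ dz₂₁ ∧ dz₂₂` (translation invariant), evaluated on
four tangent vectors. -/
def dZ4 (v : Fin 4 → HC) : ℂ :=
  (Matrix.of fun k => ![v k 0 0, v k 0 1, v k 1 0, v k 1 1]).det

theorem dZ4_basis : dZ4 basis = -4 * I := by
  simp [dZ4, basis, Matrix.det_succ_row_zero, Fin.sum_univ_succ, Fin.succAbove]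
  ring_nf

/-- Absolute convergence of `∫_𝕄 f(Z) dZ⁴`. -/
def IntegrableM (f : HC → ℂ) : Prop :=
  Integrable (fun y : Fin 4 → ℝ => f (point y) * dZ4 basis)

/-- `∫_𝕄 f(Z) dZ⁴`, with `𝕄` oriented by `ẽ₀, e₁, e₂, e₃`: the pullback of the form `f(Z) dZ⁴`
under the oriented linear parametrization `y ↦ y⁰ ẽ₀ + y¹ e₁ + y² e₂ + y³ e₃` is
`f(Z(y)) dZ⁴(ẽ₀, e₁, e₂, e₃) dy⁰ ∧ dy¹ ∧ dy² ∧ dy³`. -/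
def integralM (f : HC → ℂ) : ℂ :=
  ∫ y : Fin 4 → ℝ, f (point y) * dZ4 basis

/-- The pairing `⟨F₁, F₂⟩₁ = i / (8π³) ∫_𝕄 F₁(Z) F₂(Z) dZ⁴`. -/
def pairing (F₁ F₂ : HC → ℂ) : ℂ :=
  I / (8 * (Real.pi : ℂ) ^ 3) * integralM (fun Z => F₁ Z * F₂ Z)

end HC

end

/-!
The transform `ρ₁(γ⁻¹) F` lives on the bounded domain `𝔻⁺`, and the Cayley transform carries `𝕄`
into the Shilov boundary `U(2)` of `𝔻⁺`; the integral for `W = -1`, the preimage of the centre of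
`𝔻⁺`, becomes a Poisson integral over `U(2)` with the weight `|N(1 - Z)|⁻⁴` on `𝕄`. In spectral
coordinates on `𝕄` this weight turns into the Weyl density on a maximal torus of `U(2)`, and the
mean value property of `ρ₁(γ⁻¹) F` on the discs `t ↦ t V` with `V ∈ U(2)` gives the value at the
centre. A general `W ∈ 𝕋⁺` is the image of `-1` under some `Z ↦ A Z A* + B` with `B ∈ 𝕄`. These
maps preserve the class of functions on `𝕋⁺` whose transforms have limits at all points of `U(2)`
(a class which, unlike `Zh(𝕄)⁺`, makes no reference to a neighbourhood of `𝔻⁺`) and multiply `dZ⁴`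
by `N(A)² N(A*)² = |N(A)|⁴`. Finally `Z ↦ -Z`, which is `V ↦ -V⁻¹` on the bounded domains, exchanges
`𝕋⁻` and `𝕋⁺`.
-/

namespace HC

open Complex Topology MeasureTheory Filter

/-! ### Tube domains and the Cayley transform -/

theorem posDef_iff_trace_det {H : HC} (hH : H.IsHermitian) :
    H.PosDef ↔ 0 < H.trace.re ∧ 0 < H.det.re := by
  rw [hH.posDef_iff_eigenvalues_pos, hH.trace_eq_sum_eigenvalues, hH.det_eq_prod_eigenvalues]
  simp only [Fin.forall_fin_two, Fin.sum_univ_two, Fin.prod_univ_two, coe_algebraMap, add_re,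
    re_ofReal_mul, ofReal_re]
  constructor
  · rintro ⟨h₀, h₁⟩
    exact ⟨add_pos h₀ h₁, mul_pos h₀ h₁⟩
  · rintro ⟨hadd, hmul⟩
    rcases pos_and_pos_or_neg_and_neg_of_mul_pos hmul with h | h
    · exact h
    · linarith [h.1, h.2]

theorem mem_tubePlus {Z : HC} : Z ∈ tubePlus ↔ (-(Z + Zᴴ)).PosDef := by
  have trace_det (Y : HC) (hY : Yᴴ = -Y) :
      ((-2 * I) • Y).PosDef ↔ (N Y).re < 0 ∧ (I * Y.trace).re < 0 := by
    have hH : ((-2 * I) • Y).IsHermitian := by simp [Matrix.IsHermitian, hY]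
    have hdet : ((-2 * I) • Y).det.re = -4 * (N Y).re := by
      rw [Matrix.det_smul, Fintype.card_fin, mul_pow, I_sq]
      norm_num [N]
    have htrace : ((-2 * I) • Y).trace.re = -2 * (I * Y.trace).re := by simp
    rw [posDef_iff_trace_det hH, hdet, htrace, and_comm]
    constructor <;> rintro ⟨h₁, h₂⟩ <;> constructor <;> linarith
  constructor
  · rintro ⟨X, hX, Y, ⟨hY, hneg⟩, rfl⟩
    convert (trace_det Y hY).2 hneg using 1
    simp only [minkowski, Set.mem_ofPred_eq] at hX hY
    simp only [Matrix.conjTranspose_add, Matrix.conjTranspose_smul, hX, hY, RCLike.star_def, conj_I]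
    module
  · intro h
    have hY : ((-I / 2 : ℂ) • (Z + Zᴴ))ᴴ = -((-I / 2 : ℂ) • (Z + Zᴴ)) := by
      simp [neg_div, add_comm]
    refine ⟨(1 / 2 : ℂ) • (Z - Zᴴ), ?_, _, ⟨hY, (trace_det _ hY).1 ?_⟩, ?_⟩
    · simp [minkowski, ← smul_neg]
    · convert h using 1
      rw [smul_smul, show -2 * I * (-I / 2) = -1 by linear_combination I_mul_I, neg_one_smul]
    · rw [smul_smul, show I * (-I / 2) = 1 / 2 by linear_combination (-1 / 2) * I_mul_I]
      module

theorem neg_mem_minkowski {Z : HC} : -Z ∈ minkowski ↔ Z ∈ minkowski := by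
  simp only [minkowski, Set.mem_ofPred_eq, Matrix.conjTranspose_neg, neg_inj]

theorem mem_tubeMinus {Z : HC} : Z ∈ tubeMinus ↔ -Z ∈ tubePlus := by
  constructor
  · rintro ⟨X, hX, Y, hY, rfl⟩
    exact ⟨-X, neg_mem_minkowski.2 hX, Y, hY, by module⟩
  · rintro ⟨X, hX, Y, hY, h⟩
    exact ⟨-X, neg_mem_minkowski.2 hX, Y, hY, by rw [← neg_neg Z, h]; module⟩

theorem neg_one_mem_tubePlus : (-1 : HC) ∈ tubePlus := by
  rw [mem_tubePlus]
  convert (Matrix.PosDef.one (n := Fin 2) (R := ℂ)).add Matrix.PosDef.one using 1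
  simp

theorem minkowski_subset_closure_tubePlus : minkowski ⊆ closure tubePlus := by
  intro Z hZ
  have h : Tendsto (fun t : ℝ => Z + t • (-1 : HC)) (𝓝[>] 0) (𝓝 Z) := by
    have : Continuous fun t : ℝ => Z + t • (-1 : HC) := by fun_prop
    simpa using (this.tendsto 0).mono_left nhdsWithin_le_nhds
  refine mem_closure_of_tendsto h (eventually_nhdsWithin_of_forall fun t (ht : 0 < t) => ?_)
  rw [mem_tubePlus]
  convert (mem_tubePlus.1 neg_one_mem_tubePlus).smul ht using 1
  have hZ' : Zᴴ = -Z := hZ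
  simp only [Matrix.conjTranspose_add, Matrix.conjTranspose_neg, Matrix.conjTranspose_one,
    Matrix.conjTranspose_smul, star_trivial, hZ']
  module

theorem minkowski_subset_closure_tubeMinus : minkowski ⊆ closure tubeMinus := by
  intro Z hZ
  have h : Neg.neg ⁻¹' tubePlus = tubeMinus := Set.ext fun Z => mem_tubeMinus.symm
  rw [← h, ← Homeomorph.coe_neg, ← Homeomorph.preimage_closure]
  exact minkowski_subset_closure_tubePlus (neg_mem_minkowski.2 hZ)

theorem det_ne_zero_of_posDef_add_conjTranspose {n 𝕜 : Type*} [Fintype n] [DecidableEq n]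
    [RCLike 𝕜] {T : Matrix n n 𝕜} (h : (T + Tᴴ).PosDef) : T.det ≠ 0 := by
  intro h0
  obtain ⟨v, hv, hTv⟩ := Matrix.exists_mulVec_eq_zero_iff.2 h0
  have hpos := h.dotProduct_mulVec_pos hv
  rw [Matrix.add_mulVec, dotProduct_add, hTv, Matrix.dotProduct_mulVec, ← Matrix.star_mulVec,
    hTv] at hpos
  simp at hpos

theorem det_one_sub_ne_zero_of_mem_tubePlus {Z : HC} (h : Z ∈ tubePlus) : (1 - Z).det ≠ 0 := by
  apply det_ne_zero_of_posDef_add_conjTranspose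
  have hsum : (1 - Z) + (1 - Z)ᴴ = -(Z + Zᴴ) + -(-1 + (-1 : HC)ᴴ) := by
    rw [Matrix.conjTranspose_sub, Matrix.conjTranspose_neg, Matrix.conjTranspose_one]
    abel
  rw [hsum]
  exact (mem_tubePlus.1 h).add (mem_tubePlus.1 neg_one_mem_tubePlus)

theorem det_one_sub_ne_zero_of_mem_minkowski {Z : HC} (h : Z ∈ minkowski) : (1 - Z).det ≠ 0 := by
  apply det_ne_zero_of_posDef_add_conjTranspose
  have hZ : Zᴴ = -Z := h
  have hsum : (1 - Z) + (1 - Z)ᴴ = -(-1 + (-1 : HC)ᴴ) := by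
    rw [Matrix.conjTranspose_sub, Matrix.conjTranspose_neg, Matrix.conjTranspose_one, hZ]
    abel
  rw [hsum]
  exact mem_tubePlus.1 neg_one_mem_tubePlus

/-- The Cayley transform `Z ↦ i (1 + Z) (1 - Z)⁻¹`, the inverse of `ofDisc`; it maps `𝕋⁺` to `𝔻⁺`
and `𝕄` into the Shilov boundary `U(2)` of `𝔻⁺`. -/
noncomputable def toDisc (Z : HC) : HC := I • ((1 + Z) * (1 - Z)⁻¹)

/-- The Cayley transform `V ↦ (V - i) (V + i)⁻¹` underlying `ρ₁(γ⁻¹)`; it maps `𝔻⁺` to `𝕋⁺`. -/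
noncomputable def ofDisc (V : HC) : HC := (V - I • (1 : HC)) * (V + I • (1 : HC))⁻¹

theorem one_sub_mul_toDisc {Z : HC} (h : (1 - Z).det ≠ 0) :
    (1 - Z) * toDisc Z = I • (1 + Z) := by
  have hcomm : (1 - Z) * (1 + Z) = (1 + Z) * (1 - Z) := by noncomm_ring
  rw [toDisc, mul_smul_comm, ← mul_assoc, hcomm,
    Matrix.mul_nonsing_inv_cancel_right _ _ (isUnit_iff_ne_zero.2 h)]

theorem add_I_mul_ofDisc {V : HC} (h : (V + I • (1 : HC)).det ≠ 0) :
    (V + I • (1 : HC)) * ofDisc V = V - I • (1 : HC) := by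
  have hcomm : Commute (V + I • (1 : HC)) (V - I • (1 : HC)) := by
    have hV : Commute V (I • (1 : HC)) := (Commute.one_right V).smul_right I
    exact ((Commute.refl V).sub_right hV).add_left (hV.symm.sub_right (Commute.refl _))
  rw [ofDisc, ← mul_assoc, hcomm.eq,
    Matrix.mul_nonsing_inv_cancel_right _ _ (isUnit_iff_ne_zero.2 h)]

theorem ofDisc_mul_add_I {V : HC} (h : (V + I • (1 : HC)).det ≠ 0) :
    ofDisc V * (V + I • (1 : HC)) = V - I • (1 : HC) :=
  Matrix.nonsing_inv_mul_cancel_right _ _ (isUnit_iff_ne_zero.2 h)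

theorem ofDisc_zero : ofDisc 0 = -1 := by
  have h : (-1 : HC) * (0 + I • (1 : HC)) = 0 - I • (1 : HC) := by simp
  rw [ofDisc, ← h, Matrix.mul_nonsing_inv_cancel_right]
  simp

theorem toDisc_add_I {Z : HC} (h : (1 - Z).det ≠ 0) :
    toDisc Z + I • (1 : HC) = (2 * I) • (1 - Z)⁻¹ := by
  have hinv : (1 - Z) * (1 - Z)⁻¹ = 1 := Matrix.mul_nonsing_inv _ (isUnit_iff_ne_zero.2 h)
  calc toDisc Z + I • (1 : HC) = I • ((1 + Z) * (1 - Z)⁻¹ + (1 - Z) * (1 - Z)⁻¹) := by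
        rw [hinv, smul_add, toDisc]
    _ = (2 * I) • (1 - Z)⁻¹ := by
        rw [← add_mul, add_add_sub_cancel, one_add_one_eq_two, two_mul, ← two_smul ℂ, smul_smul,
          mul_comm I]

theorem toDisc_sub_I {Z : HC} (h : (1 - Z).det ≠ 0) :
    toDisc Z - I • (1 : HC) = Z * (toDisc Z + I • (1 : HC)) := by
  have hinv : (1 - Z) * (1 - Z)⁻¹ = 1 := Matrix.mul_nonsing_inv _ (isUnit_iff_ne_zero.2 h)
  calc toDisc Z - I • (1 : HC) = I • ((1 + Z) * (1 - Z)⁻¹ - (1 - Z) * (1 - Z)⁻¹) := by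
        rw [hinv, smul_sub, toDisc]
    _ = Z * (toDisc Z + I • (1 : HC)) := by
        rw [← sub_mul, add_sub_sub_cancel, toDisc_add_I h, ← two_smul ℂ, smul_mul_assoc, smul_smul,
          mul_smul_comm, mul_comm I]

theorem N_toDisc_add_I {Z : HC} (h : (1 - Z).det ≠ 0) :
    N (toDisc Z + I • (1 : HC)) = -4 / N (1 - Z) := by
  rw [toDisc_add_I h, N, N, Matrix.det_smul, Matrix.det_nonsing_inv, Ring.inverse_eq_inv',
    Fintype.card_fin, mul_pow, I_sq, div_eq_mul_inv]
  norm_num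

theorem ofDisc_toDisc {Z : HC} (h : (1 - Z).det ≠ 0) : ofDisc (toDisc Z) = Z := by
  rw [ofDisc, toDisc_sub_I h, Matrix.mul_nonsing_inv_cancel_right]
  rw [isUnit_iff_ne_zero, ← N, N_toDisc_add_I h]
  exact div_ne_zero (by norm_num) h

theorem one_sub_mul_toDisc_gram {Z : HC} (h : (1 - Z).det ≠ 0) :
    (1 - Z) * (1 - toDisc Z * (toDisc Z)ᴴ) * (1 - Z)ᴴ = (2 : ℝ) • -(Z + Zᴴ) := by
  have hgram : (1 - Z) * (toDisc Z * (toDisc Z)ᴴ) * (1 - Z)ᴴ = (1 + Z) * (1 + Z)ᴴ := by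
    rw [← mul_assoc, mul_assoc, ← Matrix.conjTranspose_mul, one_sub_mul_toDisc h,
      Matrix.conjTranspose_smul, smul_mul_smul_comm]
    simp
  rw [mul_sub, sub_mul, hgram, two_smul]
  simp only [Matrix.conjTranspose_sub, Matrix.conjTranspose_add, Matrix.conjTranspose_one]
  noncomm_ring

theorem toDisc_mem_discPlus {Z : HC} (h : Z ∈ tubePlus) : toDisc Z ∈ discPlus := by
  have hdet := det_one_sub_ne_zero_of_mem_tubePlus h
  have hU : IsUnit (1 - Z) := (Matrix.isUnit_iff_isUnit_det _).2 (isUnit_iff_ne_zero.2 hdet)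
  refine (Matrix.IsUnit.posDef_star_right_conjugate_iff hU).1 ?_
  rw [Matrix.star_eq_conjTranspose, one_sub_mul_toDisc_gram hdet]
  exact (mem_tubePlus.1 h).smul two_pos

theorem toDisc_mem_unitaryGroup {Z : HC} (h : Z ∈ minkowski) :
    toDisc Z ∈ Matrix.unitaryGroup (Fin 2) ℂ := by
  have hdet := det_one_sub_ne_zero_of_mem_minkowski h
  have hU : IsUnit (1 - Z) := (Matrix.isUnit_iff_isUnit_det _).2 (isUnit_iff_ne_zero.2 hdet)
  have hgram := one_sub_mul_toDisc_gram hdet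
  have hZ : Zᴴ = -Z := h
  rw [hZ, add_neg_cancel, neg_zero, smul_zero] at hgram
  have hU' : IsUnit (1 - Z)ᴴ := hU.star
  rw [hU'.mul_left_eq_zero, hU.mul_right_eq_zero, sub_eq_zero] at hgram
  exact Matrix.mem_unitaryGroup_iff.2 hgram.symm

theorem det_add_I_ne_zero_of_mem_discPlus {V : HC} (h : V ∈ discPlus) :
    (V + I • (1 : HC)).det ≠ 0 := by
  have hpos : (-I • (V + I • (1 : HC)) + (-I • (V + I • (1 : HC)))ᴴ).PosDef := by
    have hsplit : -I • (V + I • (1 : HC)) + (-I • (V + I • (1 : HC)))ᴴ =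
        (1 - V * Vᴴ) + (V + I • (1 : HC)) * (V + I • (1 : HC))ᴴ := by
      simp only [Matrix.conjTranspose_add, Matrix.conjTranspose_one, Matrix.conjTranspose_smul,
        RCLike.star_def, conj_I, map_neg, smul_add, smul_smul, mul_add, add_mul, mul_smul_comm,
        smul_mul_assoc, mul_one, one_mul, neg_mul, I_mul_I, neg_neg, one_smul]
      module
    rw [hsplit]
    exact Matrix.PosDef.add_posSemidef h (Matrix.posSemidef_self_mul_conjTranspose _)
  intro h0
  exact det_ne_zero_of_posDef_add_conjTranspose hpos (by rw [Matrix.det_smul, h0, mul_zero])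

theorem ofDisc_mem_tubePlus {V : HC} (h : V ∈ discPlus) : ofDisc V ∈ tubePlus := by
  have hdet := det_add_I_ne_zero_of_mem_discPlus h
  have hU : IsUnit (V + I • (1 : HC)) :=
    (Matrix.isUnit_iff_isUnit_det _).2 (isUnit_iff_ne_zero.2 hdet)
  rw [mem_tubePlus, ← Matrix.IsUnit.posDef_star_right_conjugate_iff hU,
    Matrix.star_eq_conjTranspose]
  convert Matrix.PosDef.smul h (two_pos (α := ℝ)) using 1
  have hstar : (ofDisc V)ᴴ * (V + I • (1 : HC))ᴴ = (V - I • (1 : HC))ᴴ := by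
    rw [← Matrix.conjTranspose_mul, add_I_mul_ofDisc hdet]
  rw [mul_neg, neg_mul, mul_add, add_mul, add_I_mul_ofDisc hdet, mul_assoc, hstar]
  simp only [Matrix.conjTranspose_add, Matrix.conjTranspose_sub, Matrix.conjTranspose_one,
    Matrix.conjTranspose_smul, RCLike.star_def, conj_I, mul_add, mul_sub, add_mul, sub_mul,
    smul_mul_assoc, one_mul, two_smul, neg_smul, smul_neg, smul_smul, I_mul_I]
  module

/-! ### Limits on the Shilov boundary -/

theorem smul_mem_discPlus {V : HC} (hV : V ∈ Matrix.unitaryGroup (Fin 2) ℂ) {c : ℂ}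
    (hc : ‖c‖ < 1) : c • V ∈ discPlus := by
  have hgram : 1 - (c • V) * (c • V)ᴴ = (1 - ‖c‖ ^ 2 : ℝ) • (1 : HC) := by
    rw [Matrix.conjTranspose_smul, smul_mul_smul_comm, ← Matrix.star_eq_conjTranspose,
      Matrix.mem_unitaryGroup_iff.1 hV, RCLike.star_def, mul_conj, normSq_eq_norm_sq, coe_smul,
      sub_smul, one_smul]
  have hpos : 0 < 1 - ‖c‖ ^ 2 := sub_pos.2 (pow_lt_one₀ (norm_nonneg c) hc two_ne_zero)
  rw [discPlus, Set.mem_ofPred_eq, hgram]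
  exact Matrix.PosDef.one.smul hpos

theorem smul_mem_discMinus {V : HC} (hV : V ∈ Matrix.unitaryGroup (Fin 2) ℂ) {c : ℂ}
    (hc : 1 < ‖c‖) : c • V ∈ discMinus := by
  have hgram : (c • V) * (c • V)ᴴ - 1 = (‖c‖ ^ 2 - 1 : ℝ) • (1 : HC) := by
    rw [Matrix.conjTranspose_smul, smul_mul_smul_comm, ← Matrix.star_eq_conjTranspose,
      Matrix.mem_unitaryGroup_iff.1 hV, RCLike.star_def, mul_conj, normSq_eq_norm_sq, coe_smul,
      sub_smul, one_smul]
  rw [discMinus, Set.mem_ofPred_eq, hgram]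
  exact Matrix.PosDef.one.smul (sub_pos.2 (one_lt_pow₀ hc two_ne_zero))

theorem smul_mem_unitaryGroup {V : HC} (hV : V ∈ Matrix.unitaryGroup (Fin 2) ℂ) {c : ℂ}
    (hc : ‖c‖ = 1) : c • V ∈ Matrix.unitaryGroup (Fin 2) ℂ := by
  rw [Matrix.mem_unitaryGroup_iff, star_smul, smul_mul_smul_comm, Matrix.mem_unitaryGroup_iff.1 hV,
    RCLike.star_def, mul_conj, normSq_eq_norm_sq, hc]
  simp

theorem tendsto_ofReal_smul (V : HC) (s : Set ℝ) :
    Tendsto (fun r : ℝ => (r : ℂ) • V) (𝓝[s] 1) (𝓝 V) := by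
  have h : Continuous fun r : ℝ => (r : ℂ) • V := by fun_prop
  simpa using (h.tendsto 1).mono_left nhdsWithin_le_nhds

theorem unitaryGroup_subset_closure_discPlus :
    (Matrix.unitaryGroup (Fin 2) ℂ : Set HC) ⊆ closure discPlus := by
  intro V hV
  refine mem_closure_of_tendsto (tendsto_ofReal_smul V (Set.Iio 1)) ?_
  filter_upwards [Ioo_mem_nhdsLT zero_lt_one] with r hr
  exact smul_mem_discPlus hV (by simpa [abs_of_pos hr.1] using hr.2)

theorem unitaryGroup_subset_closure_discMinus :
    (Matrix.unitaryGroup (Fin 2) ℂ : Set HC) ⊆ closure discMinus := by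
  intro V hV
  refine mem_closure_of_tendsto (tendsto_ofReal_smul V (Set.Ioi 1)) ?_
  filter_upwards [self_mem_nhdsWithin] with r (hr : 1 < r)
  exact smul_mem_discMinus hV (by simpa [abs_of_pos (one_pos.trans hr)] using hr)

section Holomorphy

open scoped Matrix.Norms.Operator

theorem differentiableAt_matrix_inv {n : Type*} [Fintype n] [DecidableEq n] {Z : Matrix n n ℂ}
    (h : Z.det ≠ 0) : DifferentiableAt ℂ (fun Z : Matrix n n ℂ => Z⁻¹) Z := by
  simp only [Matrix.nonsing_inv_eq_ringInverse]
  exact differentiableAt_inverse ((Matrix.isUnit_iff_isUnit_det _).2 (isUnit_iff_ne_zero.2 h))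

theorem continuousAt_matrix_inv {n : Type*} [Fintype n] [DecidableEq n] {Z : Matrix n n ℂ}
    (h : Z.det ≠ 0) : ContinuousAt (fun Z : Matrix n n ℂ => Z⁻¹) Z :=
  (differentiableAt_matrix_inv h).continuousAt

theorem differentiable_N : Differentiable ℂ N := by
  have (i j : Fin 2) : Differentiable ℂ fun Z : HC => Z i j :=
    (Matrix.entryLinearMap ℂ ℂ i j).toContinuousLinearMap.differentiable
  unfold N
  simp only [Matrix.det_fin_two]
  fun_prop

theorem continuous_N : Continuous N := differentiable_N.continuous

theorem continuousAt_toDisc {Z : HC} (h : (1 - Z).det ≠ 0) : ContinuousAt toDisc Z := by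
  have hinv : ContinuousAt (fun Z : HC => (1 - Z)⁻¹) Z :=
    (continuousAt_matrix_inv h).comp (f := fun Z : HC => 1 - Z) (by fun_prop)
  exact ((continuousAt_const.add continuousAt_id).mul hinv).const_smul I

theorem differentiableAt_ofDisc {V : HC} (h : (V + I • (1 : HC)).det ≠ 0) :
    DifferentiableAt ℂ ofDisc V := by
  have hinv : DifferentiableAt ℂ (fun V : HC => (V + I • (1 : HC))⁻¹) V :=
    (differentiableAt_matrix_inv h).comp (f := fun V : HC => V + I • (1 : HC)) V (by fun_prop)
  exact (differentiableAt_id.sub_const (I • (1 : HC))).mul hinv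

theorem differentiableOn_rho1_cayley_inv {F : HC → ℂ} (hF : DifferentiableOn ℂ F tubePlus) :
    DifferentiableOn ℂ (rho1 cayley⁻¹ F) discPlus := by
  have hdet : ∀ V ∈ discPlus, N (V + I • (1 : HC)) ≠ 0 := fun V hV =>
    det_add_I_ne_zero_of_mem_discPlus hV
  have hN : DifferentiableOn ℂ (fun V => N (V + I • (1 : HC))) discPlus :=
    (differentiable_N.comp (differentiable_id.add_const _)).differentiableOn
  have hcomp : DifferentiableOn ℂ (fun V => F (ofDisc V)) discPlus :=
    hF.comp (fun V hV => (differentiableAt_ofDisc (hdet V hV)).differentiableWithinAt)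
      fun V hV => ofDisc_mem_tubePlus hV
  have hinv := (hN.fun_pow 2).fun_inv fun V hV => pow_ne_zero 2 (hdet V hV)
  exact ((hcomp.const_mul (-4)).mul hinv).congr fun V _ => rho1_cayley_inv F V

end Holomorphy

theorem eq_rho1_cayley_inv_toDisc (F : HC → ℂ) {Z : HC} (h : (1 - Z).det ≠ 0) :
    F Z = -4 * rho1 cayley⁻¹ F (toDisc Z) / N (1 - Z) ^ 2 := by
  have hN : N (1 - Z) ≠ 0 := h
  rw [rho1_cayley_inv, ← ofDisc, ofDisc_toDisc h, N_toDisc_add_I h]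
  field_simp

/-- Functions that are holomorphic on the tube domain `T` and whose transform `ρ₁(γ⁻¹) F`, a
function on the bounded domain `D`, has a limit at every point of the Shilov boundary `U(2)` of
`𝔻⁺`. Used with `(T, D) = (𝕋⁺, 𝔻⁺)` and `(𝕋⁻, 𝔻⁻)`. -/
structure HasShilovLimits (T D : Set HC) (F : HC → ℂ) : Prop where
  differentiableOn : DifferentiableOn ℂ F T
  exists_tendsto : ∀ V ∈ Matrix.unitaryGroup (Fin 2) ℂ,
    ∃ c, Tendsto (rho1 cayley⁻¹ F) (𝓝[D] V) (𝓝 c)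

/-- The transform `ρ₁(γ⁻¹) F` on `𝔻⁺` extended by its boundary values. -/
noncomputable def discForm (F : HC → ℂ) : HC → ℂ := extendFrom discPlus (rho1 cayley⁻¹ F)

section DiscForm

variable {F : HC → ℂ}

open scoped Matrix.Norms.Operator in
theorem discForm_of_mem_discPlus (hF : DifferentiableOn ℂ F tubePlus) {V : HC}
    (hV : V ∈ discPlus) : discForm F V = rho1 cayley⁻¹ F V :=
  extendFrom_extends (differentiableOn_rho1_cayley_inv hF).continuousOn V hV

open scoped Matrix.Norms.Operator in
theorem continuousOn_discForm (hF : HasShilovLimits tubePlus discPlus F) :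
    ContinuousOn (discForm F) (discPlus ∪ (Matrix.unitaryGroup (Fin 2) ℂ : Set HC)) := by
  refine continuousOn_extendFrom
    (Set.union_subset subset_closure unitaryGroup_subset_closure_discPlus) ?_
  rintro V (hV | hV)
  · exact ⟨_, (differentiableOn_rho1_cayley_inv hF.differentiableOn).continuousOn V hV⟩
  · exact hF.exists_tendsto V hV

open scoped Matrix.Norms.Operator in
theorem circleAverage_discForm (hF : HasShilovLimits tubePlus discPlus F) {V : HC}
    (hV : V ∈ Matrix.unitaryGroup (Fin 2) ℂ) :
    Real.circleAverage (fun t : ℂ => discForm F (t • V)) 0 1 = -4 * F (-1) := by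
  have hball : Set.MapsTo (fun t : ℂ => t • V) (Metric.ball 0 1) discPlus := fun t ht =>
    smul_mem_discPlus hV (mem_ball_zero_iff.1 ht)
  have hclosed : Set.MapsTo (fun t : ℂ => t • V) (Metric.closedBall 0 1)
      (discPlus ∪ (Matrix.unitaryGroup (Fin 2) ℂ : Set HC)) := fun t ht =>
    (mem_closedBall_zero_iff.1 ht).lt_or_eq.imp (smul_mem_discPlus hV) (smul_mem_unitaryGroup hV)
  have hdiff : DifferentiableOn ℂ (discForm F) discPlus :=
    (differentiableOn_rho1_cayley_inv hF.differentiableOn).congr fun V hV =>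
      discForm_of_mem_discPlus hF.differentiableOn hV
  have hcl : DiffContOnCl ℂ (fun t : ℂ => discForm F (t • V)) (Metric.ball 0 |1|) := by
    rw [abs_one]
    refine ⟨hdiff.comp (by fun_prop) hball, ?_⟩
    rw [closure_ball _ one_ne_zero]
    exact (continuousOn_discForm hF).comp (by fun_prop) hclosed
  have h0 : (0 : HC) ∈ discPlus := by simpa using hball (Metric.mem_ball_self one_pos)
  rw [hcl.circleAverage, zero_smul, discForm_of_mem_discPlus hF.differentiableOn h0,
    rho1_cayley_inv, ← ofDisc, ofDisc_zero]
  simp [N]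

theorem tendsto_nhdsWithin_tubePlus (hF : HasShilovLimits tubePlus discPlus F) {Z : HC}
    (hZ : Z ∈ minkowski) :
    Tendsto F (𝓝[tubePlus] Z) (𝓝 (-4 * discForm F (toDisc Z) / N (1 - Z) ^ 2)) := by
  have hdet := det_one_sub_ne_zero_of_mem_minkowski hZ
  have hDisc : Tendsto toDisc (𝓝[tubePlus] Z) (𝓝[discPlus] (toDisc Z)) :=
    tendsto_nhdsWithin_iff.2 ⟨(continuousAt_toDisc hdet).mono_left nhdsWithin_le_nhds,
      eventually_nhdsWithin_of_forall fun Z hZ => toDisc_mem_discPlus hZ⟩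
  have hlim := tendsto_extendFrom (hF.exists_tendsto _ (toDisc_mem_unitaryGroup hZ))
  have hN : Tendsto (fun Z => N (1 - Z) ^ 2) (𝓝[tubePlus] Z) (𝓝 (N (1 - Z) ^ 2)) :=
    (((continuous_N.comp (continuous_const.sub continuous_id)).pow 2).tendsto Z).mono_left
      nhdsWithin_le_nhds
  refine (((hlim.comp hDisc).const_mul (-4)).div hN (pow_ne_zero 2 hdet)).congr' ?_
  exact eventually_nhdsWithin_of_forall fun Z hZ =>
    (eq_rho1_cayley_inv_toDisc F (det_one_sub_ne_zero_of_mem_tubePlus hZ)).symm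

theorem extendFrom_tubePlus_eq (hF : HasShilovLimits tubePlus discPlus F) {Z : HC}
    (hZ : Z ∈ minkowski) :
    extendFrom tubePlus F Z = -4 * discForm F (toDisc Z) / N (1 - Z) ^ 2 :=
  extendFrom_eq (minkowski_subset_closure_tubePlus hZ) (tendsto_nhdsWithin_tubePlus hF hZ)

end DiscForm

/-! ### Integration over the torus -/

/-- The one-variable Cayley transform `s ↦ (1 - is)/(1 + is)` from the real line to the circle,
which is the effect of `-i · toDisc` on an eigenvalue `-is` of a point of `𝕄`. -/
noncomputable def lineToCircle (s : ℝ) : ℂ := (1 - I * s) / (1 + I * s)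

theorem one_add_I_mul_ne_zero (s : ℝ) : (1 + I * s : ℂ) ≠ 0 := by
  intro h
  simpa using congrArg Complex.re h

theorem lineToCircle_mem_sphere (s : ℝ) : lineToCircle s ∈ Metric.sphere (0 : ℂ) 1 := by
  have hconj : (1 - I * s : ℂ) = (starRingEnd ℂ) (1 + I * s) := by simp [sub_eq_add_neg]
  rw [mem_sphere_zero_iff_norm, lineToCircle, norm_div, hconj, RCLike.norm_conj,
    div_self (norm_ne_zero_iff.2 (one_add_I_mul_ne_zero s))]

theorem continuous_lineToCircle : Continuous lineToCircle := by
  unfold lineToCircle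
  exact Continuous.div (by fun_prop) (by fun_prop) one_add_I_mul_ne_zero

/-- The point `exp (-2ia)` of the circle, which is `lineToCircle (tan a)`. -/
noncomputable def circleOfAngle (a : ℝ) : ℂ := Circle.exp (-2 * a)

theorem circleOfAngle_eq (a : ℝ) : circleOfAngle a = exp ((-2 * a : ℝ) * I) := Circle.coe_exp _

theorem circleOfAngle_mem_sphere (a : ℝ) : circleOfAngle a ∈ Metric.sphere (0 : ℂ) 1 :=
  mem_sphere_zero_iff_norm.2 (Circle.norm_coe _)

theorem continuous_circleOfAngle : Continuous circleOfAngle := by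
  unfold circleOfAngle
  fun_prop

theorem circleOfAngle_zero : circleOfAngle 0 = 1 := by simp [circleOfAngle]

theorem circleOfAngle_add (a b : ℝ) :
    circleOfAngle (a + b) = circleOfAngle a * circleOfAngle b := by
  simp [circleOfAngle, mul_add, Circle.exp_add]

theorem periodic_circleOfAngle : Function.Periodic circleOfAngle Real.pi := by
  intro a
  rw [circleOfAngle_add, circleOfAngle_eq Real.pi]
  have hpi : ((-2 * Real.pi : ℝ) : ℂ) * I = -(2 * Real.pi * I) := by push_cast; ring
  rw [hpi, exp_neg, exp_two_pi_mul_I, inv_one, mul_one]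

theorem lineToCircle_tan {a : ℝ} (ha : Real.cos a ≠ 0) :
    lineToCircle (Real.tan a) = circleOfAngle a := by
  have hcos : (Real.cos a : ℂ) ≠ 0 := ofReal_ne_zero.2 ha
  have hadd : 1 + I * (Real.tan a : ℂ) = exp (a * I) / Real.cos a := by
    rw [exp_mul_I, Real.tan_eq_sin_div_cos, ← ofReal_cos, ← ofReal_sin, ofReal_div]
    field_simp
  have hsub : 1 - I * (Real.tan a : ℂ) = exp (-a * I) / Real.cos a := by
    rw [exp_mul_I, Real.tan_eq_sin_div_cos, Complex.cos_neg, Complex.sin_neg, ← ofReal_cos,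
      ← ofReal_sin, ofReal_div]
    field_simp
    ring
  rw [lineToCircle, hadd, hsub, div_div_div_cancel_right₀ hcos, ← exp_sub, circleOfAngle_eq]
  congr 1
  push_cast
  ring

section Torus

variable {E : Type*} [NormedAddCommGroup E] [NormedSpace ℝ E]

theorem integral_eq_setIntegral_tan (f : ℝ → E) :
    ∫ s, f s =
      ∫ a in Set.Ioo (-(Real.pi / 2)) (Real.pi / 2), (1 + Real.tan a ^ 2) • f (Real.tan a) := by
  have hderiv : ∀ a ∈ Set.Ioo (-(Real.pi / 2)) (Real.pi / 2), HasDerivWithinAt Real.tan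
      (1 + Real.tan a ^ 2) (Set.Ioo (-(Real.pi / 2)) (Real.pi / 2)) a := by
    intro a ha
    have h := (Real.hasDerivAt_tan_of_mem_Ioo ha).hasDerivWithinAt
      (s := Set.Ioo (-(Real.pi / 2)) (Real.pi / 2))
    rwa [one_div, ← Real.inv_one_add_tan_sq (Real.cos_pos_of_mem_Ioo ha).ne', inv_inv] at h
  have h := integral_image_eq_integral_abs_deriv_smul measurableSet_Ioo hderiv Real.injOn_tan f
  rw [Real.image_tan_Ioo, setIntegral_univ] at h
  rw [h]
  refine setIntegral_congr_fun measurableSet_Ioo fun a _ => ?_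
  simp only [abs_of_pos (show 0 < 1 + Real.tan a ^ 2 by positivity)]

/-- The function `φ(e(s), e(t)) (s - t)² / ((1 + s²)² (1 + t²)²)` with `e = lineToCircle`: in the
angles of `e(s)` and `e(t)` the weight is the Weyl density of the maximal torus of `U(2)`. -/
noncomputable def torusIntegrand (φ : ℂ → ℂ → E) (s t : ℝ) : E :=
  ((s - t) ^ 2 * ((1 + s ^ 2)⁻¹ * (1 + t ^ 2)⁻¹) ^ 2) • φ (lineToCircle s) (lineToCircle t)

variable {φ : ℂ → ℂ → E} {M : E}

theorem continuous_torusIntegrand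
    (hφ : ContinuousOn (Function.uncurry φ) (Metric.sphere 0 1 ×ˢ Metric.sphere 0 1)) :
    Continuous (Function.uncurry (torusIntegrand φ)) := by
  have hcomp : Continuous fun p : ℝ × ℝ => φ (lineToCircle p.1) (lineToCircle p.2) :=
    hφ.comp_continuous (f := fun p : ℝ × ℝ => (lineToCircle p.1, lineToCircle p.2))
      ((continuous_lineToCircle.comp continuous_fst).prodMk
        (continuous_lineToCircle.comp continuous_snd))
      fun p => ⟨lineToCircle_mem_sphere _, lineToCircle_mem_sphere _⟩
  have hinv : Continuous fun s : ℝ => (1 + s ^ 2)⁻¹ :=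
    Continuous.inv₀ (by fun_prop) fun s => by positivity
  have hfst := hinv.comp (continuous_fst (X := ℝ) (Y := ℝ))
  have hsnd := hinv.comp (continuous_snd (X := ℝ) (Y := ℝ))
  exact Continuous.smul (by fun_prop) hcomp

theorem integrable_torusIntegrand
    (hφ : ContinuousOn (Function.uncurry φ) (Metric.sphere 0 1 ×ˢ Metric.sphere 0 1)) :
    Integrable (Function.uncurry (torusIntegrand φ)) := by
  obtain ⟨C, hC⟩ := ((isCompact_sphere (0 : ℂ) 1).prod
    (isCompact_sphere (0 : ℂ) 1)).exists_bound_of_continuousOn hφ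
  have hi : Integrable fun p : ℝ × ℝ => 2 * C * ((1 + p.1 ^ 2)⁻¹ * (1 + p.2 ^ 2)⁻¹) :=
    (integrable_inv_one_add_sq.mul_prod integrable_inv_one_add_sq).const_mul _
  refine hi.mono' (continuous_torusIntegrand hφ).aestronglyMeasurable (Eventually.of_forall ?_)
  rintro ⟨s, t⟩
  have hb : ‖φ (lineToCircle s) (lineToCircle t)‖ ≤ C :=
    hC (lineToCircle s, lineToCircle t) ⟨lineToCircle_mem_sphere _, lineToCircle_mem_sphere _⟩
  have : 0 ≤ C := (norm_nonneg _).trans hb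
  have hsq : (s - t) ^ 2 * ((1 + s ^ 2)⁻¹ * (1 + t ^ 2)⁻¹) ≤ 2 := by
    rw [← mul_inv, ← div_eq_mul_inv, div_le_iff₀ (by positivity)]
    nlinarith [sq_nonneg (s + t), sq_nonneg (s * t)]
  simp only [Function.uncurry, torusIntegrand]
  rw [norm_smul, Real.norm_of_nonneg (by positivity)]
  calc (s - t) ^ 2 * ((1 + s ^ 2)⁻¹ * (1 + t ^ 2)⁻¹) ^ 2 * ‖φ (lineToCircle s) (lineToCircle t)‖
      = ((s - t) ^ 2 * ((1 + s ^ 2)⁻¹ * (1 + t ^ 2)⁻¹)) *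
          ((1 + s ^ 2)⁻¹ * (1 + t ^ 2)⁻¹) * ‖φ (lineToCircle s) (lineToCircle t)‖ := by ring
    _ ≤ 2 * ((1 + s ^ 2)⁻¹ * (1 + t ^ 2)⁻¹) * C := by gcongr
    _ = 2 * C * ((1 + s ^ 2)⁻¹ * (1 + t ^ 2)⁻¹) := by ring

theorem intervalIntegral_comp_circleOfAngle (f : ℂ → E) :
    ∫ a in (-(Real.pi / 2))..(Real.pi / 2), f (circleOfAngle a) =
      Real.pi • Real.circleAverage f 0 1 := by
  have hper : Function.Periodic (fun θ : ℝ => f (circleMap 0 1 θ)) (2 * Real.pi) :=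
    (periodic_circleMap 0 1).comp f
  have hshift := hper.intervalIntegral_add_eq (-Real.pi) 0
  have hscale := intervalIntegral.integral_comp_mul_left (a := -(Real.pi / 2)) (b := Real.pi / 2)
    (fun θ : ℝ => f (circleMap 0 1 θ)) (show (-2 : ℝ) ≠ 0 by norm_num)
  have hmap (a : ℝ) : circleMap 0 1 (-2 * a) = circleOfAngle a := by
    rw [circleOfAngle_eq, circleMap, ofReal_one, one_mul, zero_add]
  simp only [hmap] at hscale
  rw [show -2 * (Real.pi / 2) = -Real.pi by ring,
    show -2 * -(Real.pi / 2) = -Real.pi + 2 * Real.pi by ring,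
    intervalIntegral.integral_symm (-Real.pi), hshift, zero_add] at hscale
  rw [hscale, Real.circleAverage_def, smul_smul, smul_neg, ← neg_smul]
  congr 1
  field_simp

theorem integral_torusIntegrand_eq_setIntegral (φ : ℂ → ℂ → E) :
    ∫ t, ∫ s, torusIntegrand φ s t =
      ∫ b in Set.Ioo (-(Real.pi / 2)) (Real.pi / 2), ∫ a in Set.Ioo (-(Real.pi / 2)) (Real.pi / 2),
        Real.sin (a - b) ^ 2 • φ (circleOfAngle a) (circleOfAngle b) := by
  rw [integral_eq_setIntegral_tan]
  refine setIntegral_congr_fun measurableSet_Ioo fun b hb => ?_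
  rw [integral_eq_setIntegral_tan, ← integral_smul]
  refine setIntegral_congr_fun measurableSet_Ioo fun a ha => ?_
  have ha' := (Real.cos_pos_of_mem_Ioo ha).ne'
  have hb' := (Real.cos_pos_of_mem_Ioo hb).ne'
  simp only [torusIntegrand, lineToCircle_tan ha', lineToCircle_tan hb', smul_smul]
  congr 1
  rw [Real.inv_one_add_tan_sq ha', Real.inv_one_add_tan_sq hb', ← inv_inv (1 + Real.tan a ^ 2),
    ← inv_inv (1 + Real.tan b ^ 2), Real.inv_one_add_tan_sq ha', Real.inv_one_add_tan_sq hb',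
    Real.sin_sub, Real.tan_eq_sin_div_cos, Real.tan_eq_sin_div_cos]
  field_simp

theorem setIntegral_Ioo_half_pi (f : ℝ → E) :
    ∫ a in Set.Ioo (-(Real.pi / 2)) (Real.pi / 2), f a =
      ∫ a in (-(Real.pi / 2))..(Real.pi / 2), f a := by
  rw [intervalIntegral.integral_of_le (by linarith [Real.pi_pos]), integral_Ioc_eq_integral_Ioo]

theorem setIntegral_comp_add_of_periodic {f : ℝ → E} (hf : Function.Periodic f Real.pi) (b : ℝ) :
    ∫ a in Set.Ioo (-(Real.pi / 2)) (Real.pi / 2), f (a + b) =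
      ∫ a in Set.Ioo (-(Real.pi / 2)) (Real.pi / 2), f a := by
  have h := hf.intervalIntegral_add_eq (-(Real.pi / 2) + b) (-(Real.pi / 2))
  rw [show -(Real.pi / 2) + Real.pi = Real.pi / 2 by ring, add_right_comm,
    show -(Real.pi / 2) + Real.pi = Real.pi / 2 by ring] at h
  rw [setIntegral_Ioo_half_pi, setIntegral_Ioo_half_pi, intervalIntegral.integral_comp_add_right, h]

theorem integral_torusIntegrand [CompleteSpace E]
    (hφ : ContinuousOn (Function.uncurry φ) (Metric.sphere 0 1 ×ˢ Metric.sphere 0 1))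
    (hM : ∀ v ∈ Metric.sphere (0 : ℂ) 1, ∀ w ∈ Metric.sphere (0 : ℂ) 1,
      Real.circleAverage (fun t => φ (t * v) (t * w)) 0 1 = M) :
    ∫ t, ∫ s, torusIntegrand φ s t = (Real.pi ^ 2 / 2) • M := by
  rw [integral_torusIntegrand_eq_setIntegral]
  set J := Set.Ioo (-(Real.pi / 2)) (Real.pi / 2)
  have hshift (b : ℝ) :
      ∫ a in J, Real.sin (a - b) ^ 2 • φ (circleOfAngle a) (circleOfAngle b) =
        ∫ a in J, Real.sin a ^ 2 • φ (circleOfAngle (a + b)) (circleOfAngle b) := by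
    have hper : Function.Periodic
        (fun a => Real.sin (a - b) ^ 2 • φ (circleOfAngle a) (circleOfAngle b)) Real.pi := by
      intro a
      simp only [periodic_circleOfAngle a, add_sub_right_comm, Real.sin_add_pi, neg_sq]
    simpa only [add_sub_cancel_right] using (setIntegral_comp_add_of_periodic hper b).symm
  have hmean (a : ℝ) :
      ∫ b in J, Real.sin a ^ 2 • φ (circleOfAngle (a + b)) (circleOfAngle b) =
        Real.sin a ^ 2 • Real.pi • M := by
    rw [integral_smul, setIntegral_Ioo_half_pi,
      ← hM _ (circleOfAngle_mem_sphere a) _ (circleOfAngle_mem_sphere 0),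
      ← intervalIntegral_comp_circleOfAngle]
    simp only [circleOfAngle_zero, mul_one, ← circleOfAngle_add, add_comm a]
  have hint : Integrable (Function.uncurry fun b a =>
      Real.sin a ^ 2 • φ (circleOfAngle (a + b)) (circleOfAngle b))
      ((volume.restrict J).prod (volume.restrict J)) := by
    have hcomp : Continuous fun p : ℝ × ℝ => φ (circleOfAngle (p.2 + p.1)) (circleOfAngle p.1) :=
      hφ.comp_continuous (f := fun p : ℝ × ℝ => (circleOfAngle (p.2 + p.1), circleOfAngle p.1))
        ((continuous_circleOfAngle.comp (continuous_snd.add continuous_fst)).prodMk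
          (continuous_circleOfAngle.comp continuous_fst))
        fun p => ⟨circleOfAngle_mem_sphere _, circleOfAngle_mem_sphere _⟩
    have hcont : Continuous fun p : ℝ × ℝ => Real.sin p.2 ^ 2 := by fun_prop
    rw [Measure.prod_restrict]
    exact ((hcont.smul hcomp).continuousOn.integrableOn_compact
      (isCompact_Icc.prod isCompact_Icc)).mono_set
      (Set.prod_mono Set.Ioo_subset_Icc_self Set.Ioo_subset_Icc_self)
  simp_rw [hshift]
  rw [integral_integral_swap hint]
  simp_rw [hmean]
  rw [integral_smul_const, setIntegral_Ioo_half_pi, integral_sin_sq, smul_smul]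
  congr 1
  simp only [Real.sin_neg, Real.cos_neg, Real.cos_pi_div_two]
  ring

theorem integral_torusIntegrand_add_sub [CompleteSpace E]
    (hφ : ContinuousOn (Function.uncurry φ) (Metric.sphere 0 1 ×ˢ Metric.sphere 0 1))
    (hM : ∀ v ∈ Metric.sphere (0 : ℂ) 1, ∀ w ∈ Metric.sphere (0 : ℂ) 1,
      Real.circleAverage (fun t => φ (t * v) (t * w)) 0 1 = M) :
    Integrable (fun r : ℝ => ∫ x, torusIntegrand φ (x + r) (x - r)) ∧
    ∫ r : ℝ, ∫ x, torusIntegrand φ (x + r) (x - r) = (Real.pi ^ 2 / 4) • M := by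
  have hint : Integrable fun p : ℝ × ℝ => torusIntegrand φ (p.2 + p.1) p.2 :=
    (Measure.measurePreserving_swap.comp
      (measurePreserving_prod_add_swap volume volume)).integrable_comp_of_integrable
      (integrable_torusIntegrand hφ)
  have htranslate (r : ℝ) :
      ∫ x, torusIntegrand φ (x + r) (x - r) = ∫ t, torusIntegrand φ (t + 2 * r) t := by
    rw [← integral_sub_right_eq_self (fun t => torusIntegrand φ (t + 2 * r) t) r]
    congr with x
    ring_nf
  have hinner (t : ℝ) : ∫ q, torusIntegrand φ (t + q) t = ∫ s, torusIntegrand φ s t :=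
    integral_add_left_eq_self (fun s => torusIntegrand φ s t) t
  simp only [htranslate]
  refine ⟨hint.integral_prod_left.comp_mul_left' two_ne_zero, ?_⟩
  rw [Measure.integral_comp_mul_left (fun q => ∫ t, torusIntegrand φ (t + q) t),
    integral_integral_swap hint]
  simp only [hinner]
  rw [integral_torusIntegrand hφ hM, smul_smul, abs_of_pos (by positivity)]
  congr 1
  ring

end Torus

/-! ### Integration along lines through the origin -/

theorem setIntegral_Ioi_pow_smul_add_neg {E F : Type*} [AddCommGroup E] [Module ℝ E]
    [NormedAddCommGroup F] [NormedSpace ℝ F] {m : E → F} {n : ℕ} (hn : Even n) {ω : E}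
    (hi : Integrable fun r : ℝ => r ^ n • m (r • ω)) :
    ∫ r in Set.Ioi (0 : ℝ), r ^ n • (m (r • ω) + m (-(r • ω))) =
      ∫ r : ℝ, r ^ n • m (r • ω) := by
  have hneg := integral_comp_neg_Ioi (0 : ℝ) fun r : ℝ => r ^ n • m (r • ω)
  have hi' := hi.comp_neg
  simp only [hn.neg_pow, neg_smul, neg_zero] at hneg hi'
  simp only [smul_add]
  rw [integral_add hi.integrableOn hi'.integrableOn, hneg, add_comm,
    intervalIntegral.integral_Iic_add_Ioi hi.integrableOn hi.integrableOn]

section Polar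

variable {E : Type*} [NormedAddCommGroup E] [NormedSpace ℝ E] [MeasurableSpace E] [BorelSpace E]
  [FiniteDimensional ℝ E] [Nontrivial E] (μ : Measure E) [μ.IsAddHaarMeasure]
  {F : Type*} [NormedAddCommGroup F] [NormedSpace ℝ F] {m : E → F}

theorem integral_eq_integral_toSphere_Ioi (hm : Integrable m μ) :
    ∫ x, m x ∂μ = ∫ ω : Metric.sphere (0 : E) 1, (∫ r in Set.Ioi (0 : ℝ),
      r ^ (Module.finrank ℝ E - 1) • m (r • (ω : E))) ∂μ.toSphere := by
  have hmp := μ.measurePreserving_homeomorphUnitSphereProd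
  have hemb := (homeomorphUnitSphereProd E).measurableEmbedding
  set f : Metric.sphere (0 : E) 1 × Set.Ioi (0 : ℝ) → F := fun p => m (p.2.1 • p.1.1)
  have hfm (x : ({(0 : E)}ᶜ : Set E)) : f (homeomorphUnitSphereProd E x) = m x := by
    change m ((homeomorphUnitSphereProd E x).2.1 • (homeomorphUnitSphereProd E x).1.1) = m x
    rw [← homeomorphUnitSphereProd_symm_apply_coe, Homeomorph.symm_apply_apply]
  have hf : Integrable f (μ.toSphere.prod (.volumeIoiPow (Module.finrank ℝ E - 1))) := by
    rw [← hmp.integrable_comp_emb hemb]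
    simp only [Function.comp_def, hfm]
    exact (integrableOn_iff_comap_subtypeVal (measurableSet_singleton (0 : E)).compl).1
      hm.integrableOn
  calc ∫ x, m x ∂μ = ∫ x : ({(0)}ᶜ : Set E), m x ∂(μ.comap (↑)) := by
        rw [integral_subtype_comap (measurableSet_singleton _).compl fun x => m x,
          restrict_compl_singleton]
    _ = ∫ p, f p ∂μ.toSphere.prod (.volumeIoiPow (Module.finrank ℝ E - 1)) := by
        rw [← hmp.integral_comp hemb]
        simp only [hfm]
    _ = ∫ ω : Metric.sphere (0 : E) 1, (∫ r : Set.Ioi (0 : ℝ), m (r.1 • ω.1)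
          ∂.volumeIoiPow (Module.finrank ℝ E - 1)) ∂μ.toSphere := integral_prod _ hf
    _ = _ := by
        congr 1
        ext ω
        simp only [Measure.volumeIoiPow, ENNReal.ofReal]
        rw [integral_withDensity_eq_integral_smul
            ((measurable_subtype_coe.pow_const _).real_toNNReal),
          integral_subtype_comap measurableSet_Ioi
            fun a => Real.toNNReal (a ^ (Module.finrank ℝ E - 1)) • m (a • (ω : E)),
          setIntegral_congr_fun measurableSet_Ioi fun x hx => ?_]
        rw [NNReal.smul_def, Real.coe_toNNReal _ (pow_nonneg (Set.mem_Ioi.1 hx).le _)]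

theorem integral_of_integral_line_eq [CompleteSpace F] (hd : Even (Module.finrank ℝ E - 1))
    (hm : Integrable m μ) {X : F}
    (hline : ∀ ω : E, ‖ω‖ = 1 →
      Integrable (fun r : ℝ => r ^ (Module.finrank ℝ E - 1) • m (r • ω)) ∧
      ∫ r : ℝ, r ^ (Module.finrank ℝ E - 1) • m (r • ω) = X) :
    ∫ x, m x ∂μ = (2⁻¹ * μ.toSphere.real Set.univ) • X := by
  have hpolar := integral_eq_integral_toSphere_Ioi μ (hm.add hm.comp_neg)
  have hinner (ω : Metric.sphere (0 : E) 1) : ∫ r in Set.Ioi (0 : ℝ),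
      r ^ (Module.finrank ℝ E - 1) • (m + fun x => m (-x)) (r • (ω : E)) = X := by
    obtain ⟨hi, hX⟩ := hline ω (by simp)
    exact (setIntegral_Ioi_pow_smul_add_neg hd hi).trans hX
  have hsum : ∫ x, (m + fun x => m (-x)) x ∂μ = (2 : ℝ) • ∫ x, m x ∂μ := by
    simp only [Pi.add_apply]
    rw [integral_add hm hm.comp_neg, integral_neg_eq_self, two_smul]
  simp_rw [hinner] at hpolar
  rw [integral_const, hsum] at hpolar
  rw [mul_smul, ← hpolar, smul_smul, inv_mul_cancel₀ two_ne_zero, one_smul]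

end Polar

/-- Euclidean three-space, the factor of `𝕄 ≃ ℝ × ℝ³` spanned by `e₁, e₂, e₃`. -/
abbrev E3 : Type := EuclideanSpace ℝ (Fin 3)

theorem integral_E3_of_integral_line_eq {F : Type*} [NormedAddCommGroup F] [NormedSpace ℝ F]
    [CompleteSpace F] {m : E3 → F} (hm : Integrable m) {X : F}
    (hline : ∀ ω : E3, ‖ω‖ = 1 → Integrable (fun r : ℝ => r ^ 2 • m (r • ω)) ∧
      ∫ r : ℝ, r ^ 2 • m (r • ω) = X) :
    ∫ x, m x = (2 * Real.pi) • X := by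
  have hrank : Module.finrank ℝ E3 - 1 = 2 := by simp
  rw [integral_of_integral_line_eq volume (by simp) hm (X := X) (by rwa [hrank]),
    Measure.toSphere_real_apply_univ, Measure.real, EuclideanSpace.volume_ball_fin_three,
    finrank_euclideanSpace_fin, ENNReal.toReal_mul, ENNReal.toReal_ofReal (by positivity)]
  congr 1
  simp only [ENNReal.ofReal_one, one_pow, ENNReal.toReal_one]
  push_cast
  ring

/-! ### Spectral coordinates on Minkowski space -/

/-- The identification of `ℝ × ℝ³` with `ℝ⁴`. -/
noncomputable def join : ℝ × E3 ≃ᵐ (Fin 4 → ℝ) :=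
  ((MeasurableEquiv.refl ℝ).prodCongr (MeasurableEquiv.toLp 2 (Fin 3 → ℝ)).symm).trans
    (MeasurableEquiv.piFinSuccAbove (fun _ : Fin 4 => ℝ) 0).symm

theorem join_apply (p : ℝ × E3) : join p = ![p.1, p.2 0, p.2 1, p.2 2] := by
  ext i
  fin_cases i <;> simp [join, MeasurableEquiv.piFinSuccAbove] <;> rfl

theorem continuous_join : Continuous join := by
  have h : (join : ℝ × E3 → Fin 4 → ℝ) = fun p => ![p.1, p.2 0, p.2 1, p.2 2] :=
    funext join_apply
  rw [h]
  fun_prop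

theorem measurePreserving_join : MeasurePreserving join :=
  (volume_preserving_piFinSuccAbove (fun _ : Fin 4 => ℝ) 0).symm.comp
    ((MeasurePreserving.id volume).prod (PiLp.volume_preserving_ofLp (Fin 3)))

/-- The Hermitian matrix `v⁰ σ₁ + v¹ σ₂ + v² σ₃` formed with the Pauli matrices, so that
`e₁, e₂, e₃` are the matrices `-iσ₁, -iσ₂, -iσ₃`. -/
noncomputable def spin (v : E3) : HC :=
  !![(v 2 : ℂ), v 0 - I * v 1; v 0 + I * v 1, -(v 2 : ℂ)]

theorem point_join (x r : ℝ) (v : E3) :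
    point (join (x, r • v)) = (-I * x) • (1 : HC) + (-I * r) • spin v := by
  rw [join_apply]
  ext i j
  fin_cases i <;> fin_cases j <;>
    simp [point, basis, spin, Fin.sum_univ_four]
  · ring
  · linear_combination -(r * v 1 : ℂ) * I_sq
  · linear_combination (r * v 1 : ℂ) * I_sq
  · ring

theorem ofReal_norm_sq (v : E3) :
    (‖v‖ : ℂ) ^ 2 = (v 0 : ℂ) ^ 2 + (v 1 : ℂ) ^ 2 + (v 2 : ℂ) ^ 2 := by
  have h := EuclideanSpace.real_norm_sq_eq v
  rw [Fin.sum_univ_three] at h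
  exact_mod_cast h

theorem spin_mul_spin (v : E3) : spin v * spin v = ((‖v‖ : ℂ) ^ 2) • (1 : HC) := by
  ext i j
  fin_cases i <;> fin_cases j <;>
    simp [spin, Matrix.mul_apply, Fin.sum_univ_two, ofReal_norm_sq]
  · linear_combination -(v 1 : ℂ) ^ 2 * I_sq
  · ring
  · ring
  · linear_combination -(v 1 : ℂ) ^ 2 * I_sq

theorem conjTranspose_spin (v : E3) : (spin v)ᴴ = spin v := by
  ext i j
  fin_cases i <;> fin_cases j <;> simp [spin, Matrix.conjTranspose_apply, sub_eq_add_neg]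

/-- For a unit vector `ω`, the matrix with eigenvalues `v`, `w` on the eigenspaces of `spin ω` for
the eigenvalues `1`, `-1`. -/
noncomputable def spectralPoint (ω : E3) (v w : ℂ) : HC :=
  ((v + w) / 2) • (1 : HC) + ((v - w) / 2) • spin ω

section SpectralPoint

variable {ω : E3}

theorem spectralPoint_mul (hω : ‖ω‖ = 1) (v w v' w' : ℂ) :
    spectralPoint ω v w * spectralPoint ω v' w' = spectralPoint ω (v * v') (w * w') := by
  simp only [spectralPoint, add_mul, mul_add, smul_mul_assoc, mul_smul_comm, one_mul, mul_one,
    spin_mul_spin, hω]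
  module

theorem spectralPoint_self (v : ℂ) : spectralPoint ω v v = v • (1 : HC) := by
  simp [spectralPoint]

theorem star_spectralPoint (v w : ℂ) :
    star (spectralPoint ω v w) = spectralPoint ω (star v) (star w) := by
  simp [spectralPoint, Matrix.star_eq_conjTranspose, conjTranspose_spin]

theorem smul_spectralPoint (c v w : ℂ) :
    c • spectralPoint ω v w = spectralPoint ω (c * v) (c * w) := by
  simp only [spectralPoint]
  module

theorem one_sub_spectralPoint (v w : ℂ) :
    1 - spectralPoint ω v w = spectralPoint ω (1 - v) (1 - w) := by
  simp only [spectralPoint]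
  module

theorem one_add_spectralPoint (v w : ℂ) :
    1 + spectralPoint ω v w = spectralPoint ω (1 + v) (1 + w) := by
  simp only [spectralPoint]
  module

theorem continuous_spectralPoint : Continuous fun p : ℂ × ℂ => spectralPoint ω p.1 p.2 := by
  unfold spectralPoint
  fun_prop

theorem spectralPoint_mem_unitaryGroup (hω : ‖ω‖ = 1) {v w : ℂ}
    (hv : v ∈ Metric.sphere (0 : ℂ) 1) (hw : w ∈ Metric.sphere (0 : ℂ) 1) :
    spectralPoint ω v w ∈ Matrix.unitaryGroup (Fin 2) ℂ := by
  have hunit {z : ℂ} (hz : z ∈ Metric.sphere (0 : ℂ) 1) : z * star z = 1 := by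
    rw [RCLike.star_def, mul_conj, normSq_eq_norm_sq, mem_sphere_zero_iff_norm.1 hz]
    simp
  rw [Matrix.mem_unitaryGroup_iff, star_spectralPoint, spectralPoint_mul hω, hunit hv, hunit hw,
    spectralPoint_self, one_smul]

theorem point_join_eq_spectralPoint (x r : ℝ) :
    point (join (x, r • ω)) = spectralPoint ω (-I * (x + r : ℝ)) (-I * (x - r : ℝ)) := by
  rw [point_join, spectralPoint]
  push_cast
  module

end SpectralPoint

theorem point_mem_minkowski (y : Fin 4 → ℝ) : point y ∈ minkowski :=
  range_point ▸ Set.mem_range_self y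

theorem N_one_sub_point_ne_zero (y : Fin 4 → ℝ) : N (1 - point y) ≠ 0 :=
  det_one_sub_ne_zero_of_mem_minkowski (point_mem_minkowski y)

theorem continuous_point : Continuous point := by
  unfold point
  fun_prop

theorem continuous_toDisc_point : Continuous fun y => toDisc (point y) :=
  continuous_iff_continuousAt.2 fun y =>
    (continuousAt_toDisc (N_one_sub_point_ne_zero y)).comp continuous_point.continuousAt

theorem toDisc_point_join (x r : ℝ) {ω : E3} (hω : ‖ω‖ = 1) :
    toDisc (point (join (x, r • ω))) =
      I • spectralPoint ω (lineToCircle (x + r)) (lineToCircle (x - r)) := by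
  have hline (s : ℝ) : lineToCircle s * (1 - -I * s) = 1 + -I * s := by
    have := one_add_I_mul_ne_zero s
    rw [lineToCircle]
    field_simp
    ring
  have hmul : 1 + point (join (x, r • ω)) =
      spectralPoint ω (lineToCircle (x + r)) (lineToCircle (x - r)) *
        (1 - point (join (x, r • ω))) := by
    rw [point_join_eq_spectralPoint, one_sub_spectralPoint, one_add_spectralPoint,
      spectralPoint_mul hω, hline, hline]
  rw [toDisc, hmul, mul_assoc,
    Matrix.mul_nonsing_inv _ (isUnit_iff_ne_zero.2 (N_one_sub_point_ne_zero _)), mul_one]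

theorem N_one_sub_point_join (x : ℝ) (v : E3) :
    N (1 - point (join (x, v))) = (1 + I * (x + ‖v‖ : ℝ)) * (1 + I * (x - ‖v‖ : ℝ)) := by
  have hnorm := ofReal_norm_sq v
  simp [N, join_apply, Matrix.det_fin_two, point, basis, Fin.sum_univ_four]
  linear_combination -hnorm + ((v 0 : ℂ) ^ 2 + (v 2 : ℂ) ^ 2 - (‖v‖ : ℂ) ^ 2) * (-I_sq)

/-- The function `|N(1 - Z)|⁻⁴` at `Z = point y`: up to a constant, the Jacobian of the Cayley
transform from `𝕄` to `U(2)`. -/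
noncomputable def weight (y : Fin 4 → ℝ) : ℝ := (‖N (1 - point y)‖ ^ 4)⁻¹

theorem weight_nonneg (y : Fin 4 → ℝ) : 0 ≤ weight y := by
  unfold weight
  positivity

theorem continuous_weight : Continuous weight :=
  ((continuous_N.comp (continuous_const.sub continuous_point)).norm.pow 4).inv₀ fun y =>
    pow_ne_zero 4 (norm_ne_zero_iff.2 (N_one_sub_point_ne_zero y))

theorem weight_join (x : ℝ) (v : E3) :
    weight (join (x, v)) = ((1 + (x + ‖v‖) ^ 2)⁻¹ * (1 + (x - ‖v‖) ^ 2)⁻¹) ^ 2 := by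
  have hnorm (s : ℝ) : ‖1 + I * (s : ℂ)‖ ^ 2 = 1 + s ^ 2 := by
    rw [← normSq_eq_norm_sq, mul_comm, ← ofReal_one, normSq_add_mul_I, one_pow]
  rw [weight, N_one_sub_point_join, norm_mul, ← mul_inv, ← hnorm, ← hnorm, ← mul_pow, inv_pow,
    ← pow_mul]

theorem integrable_mul_inv_one_add_sq_add_norm (c : ℝ) :
    Integrable fun p : ℝ × E3 => ((1 + ‖p.2‖ ^ 2)⁻¹) ^ 2 * (1 + (p.1 + c * ‖p.2‖) ^ 2)⁻¹ := by
  have hcont : Continuous fun p : ℝ × E3 =>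
      ((1 + ‖p.2‖ ^ 2)⁻¹) ^ 2 * (1 + (p.1 + c * ‖p.2‖) ^ 2)⁻¹ :=
    (Continuous.inv₀ (by fun_prop) fun p => by positivity).pow 2 |>.mul
      (Continuous.inv₀ (by fun_prop) fun p => by positivity)
  have hinner (v : E3) : ∫ x : ℝ, ‖((1 + ‖v‖ ^ 2)⁻¹) ^ 2 * (1 + (x + c * ‖v‖) ^ 2)⁻¹‖ =
      Real.pi * (1 + ‖v‖ ^ 2) ^ (-(4 : ℝ) / 2) := by
    have hnonneg (x : ℝ) : ‖((1 + ‖v‖ ^ 2)⁻¹) ^ 2 * (1 + (x + c * ‖v‖) ^ 2)⁻¹‖ =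
        ((1 + ‖v‖ ^ 2)⁻¹) ^ 2 * (1 + (x + c * ‖v‖) ^ 2)⁻¹ := Real.norm_of_nonneg (by positivity)
    simp_rw [hnonneg]
    rw [integral_const_mul, integral_add_right_eq_self (fun x : ℝ => (1 + x ^ 2)⁻¹),
      integral_univ_inv_one_add_sq, mul_comm, show (-(4 : ℝ) / 2) = -((2 : ℕ) : ℝ) by norm_num,
      Real.rpow_neg (by positivity), Real.rpow_natCast, inv_pow]
  refine (integrable_prod_iff' hcont.aestronglyMeasurable).2
    ⟨Eventually.of_forall fun v => ?_, ?_⟩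
  · exact (integrable_inv_one_add_sq.comp_add_right (c * ‖v‖)).const_mul (((1 + ‖v‖ ^ 2)⁻¹) ^ 2)
  · simp_rw [hinner]
    refine (integrable_rpow_neg_one_add_norm_sq ?_).const_mul _
    rw [finrank_euclideanSpace_fin]
    norm_num

theorem inv_mul_inv_sq_le (x r : ℝ) :
    ((1 + (x + r) ^ 2)⁻¹ * (1 + (x - r) ^ 2)⁻¹) ^ 2 ≤
      ((1 + r ^ 2)⁻¹) ^ 2 * ((1 + (x + r) ^ 2)⁻¹ + (1 + (x - r) ^ 2)⁻¹) := by
  set A := 1 + (x + r) ^ 2 with hA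
  set B := 1 + (x - r) ^ 2 with hB
  have hA1 : 1 ≤ A := by nlinarith [sq_nonneg (x + r)]
  have hB1 : 1 ≤ B := by nlinarith [sq_nonneg (x - r)]
  have : 0 < A := by linarith
  have : 0 < B := by linarith
  have hAB : A + B = 2 * (1 + r ^ 2) + 2 * x ^ 2 := by rw [hA, hB]; ring
  have hprod : A⁻¹ * B⁻¹ ≤ (1 + r ^ 2)⁻¹ := by
    rw [← mul_inv]
    apply inv_anti₀ (by positivity)
    nlinarith [mul_nonneg (sub_nonneg.2 hA1) (sub_nonneg.2 hB1), sq_nonneg x, sq_nonneg r]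
  have hsum : A⁻¹ * B⁻¹ ≤ (1 + r ^ 2)⁻¹ * (A⁻¹ + B⁻¹) := by
    have h : A⁻¹ + B⁻¹ = (A + B) * (A⁻¹ * B⁻¹) := by field_simp; ring
    rw [h, ← mul_assoc]
    refine le_mul_of_one_le_left (by positivity) ?_
    rw [inv_mul_eq_div, le_div_iff₀ (by positivity), hAB]
    nlinarith [sq_nonneg x, sq_nonneg r]
  calc (A⁻¹ * B⁻¹) ^ 2 = (A⁻¹ * B⁻¹) * (A⁻¹ * B⁻¹) := sq _
    _ ≤ (1 + r ^ 2)⁻¹ * ((1 + r ^ 2)⁻¹ * (A⁻¹ + B⁻¹)) := by gcongr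
    _ = ((1 + r ^ 2)⁻¹) ^ 2 * (A⁻¹ + B⁻¹) := by ring

theorem integrable_weight : Integrable weight := by
  rw [← measurePreserving_join.integrable_comp_emb join.measurableEmbedding]
  refine ((integrable_mul_inv_one_add_sq_add_norm 1).add
    (integrable_mul_inv_one_add_sq_add_norm (-1))).mono'
    (continuous_weight.comp continuous_join).aestronglyMeasurable (Eventually.of_forall ?_)
  rintro ⟨x, v⟩
  rw [Function.comp_apply, Real.norm_of_nonneg (weight_nonneg _), weight_join, Pi.add_apply,
    ← mul_add, one_mul, neg_one_mul, ← sub_eq_add_neg]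
  exact inv_mul_inv_sq_le x ‖v‖

theorem isCompact_unitaryGroup {n 𝕜 : Type*} [Fintype n] [DecidableEq n] [RCLike 𝕜] :
    IsCompact (Matrix.unitaryGroup n 𝕜 : Set (Matrix n n 𝕜)) := by
  have hcompact : IsCompact (Set.univ.pi fun _ : n => Set.univ.pi fun _ : n =>
      Metric.closedBall (0 : 𝕜) 1) :=
    isCompact_univ_pi fun _ => isCompact_univ_pi fun _ => isCompact_closedBall 0 1
  refine hcompact.of_isClosed_subset ?_ fun U hU i _ j _ =>
    mem_closedBall_zero_iff.2 (entry_norm_bound_of_unitary hU i j)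
  have hset : (Matrix.unitaryGroup n 𝕜 : Set (Matrix n n 𝕜)) = {U | U * star U = 1} :=
    Set.ext fun U => Matrix.mem_unitaryGroup_iff
  rw [hset]
  exact isClosed_eq (continuous_id.matrix_mul continuous_id.star) continuous_const

section Poisson

variable {E : Type*} [NormedAddCommGroup E] [NormedSpace ℝ E] {g : HC → E}

theorem integrable_weight_smul_toDisc
    (hg : ContinuousOn g (Matrix.unitaryGroup (Fin 2) ℂ : Set HC)) :
    Integrable fun y => weight y • g (toDisc (point y)) := by
  obtain ⟨C, hC⟩ := isCompact_unitaryGroup.exists_bound_of_continuousOn hg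
  have hmem (y : Fin 4 → ℝ) := toDisc_mem_unitaryGroup (point_mem_minkowski y)
  exact integrable_weight.smul_bdd C
    (hg.comp_continuous continuous_toDisc_point hmem).aestronglyMeasurable
    (Eventually.of_forall fun y => hC _ (hmem y))

theorem sq_smul_weight_smul_toDisc_join {ω : E3} (hω : ‖ω‖ = 1) (x r : ℝ) :
    r ^ 2 • weight (join (x, r • ω)) • g (toDisc (point (join (x, r • ω)))) =
      (4⁻¹ : ℝ) • torusIntegrand (fun v w => g (I • spectralPoint ω v w)) (x + r) (x - r) := by
  have habs : ((1 + (x + |r|) ^ 2)⁻¹ * (1 + (x - |r|) ^ 2)⁻¹) ^ 2 =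
      ((1 + (x + r) ^ 2)⁻¹ * (1 + (x - r) ^ 2)⁻¹) ^ 2 := by
    rcases abs_choice r with h | h <;> rw [h]
    ring
  rw [toDisc_point_join x r hω, weight_join, torusIntegrand, norm_smul, hω, mul_one,
    Real.norm_eq_abs, habs, smul_smul, smul_smul]
  congr 1
  ring

theorem integral_weight_smul_toDisc [CompleteSpace E] {M : E}
    (hg : ContinuousOn g (Matrix.unitaryGroup (Fin 2) ℂ : Set HC))
    (hM : ∀ V ∈ Matrix.unitaryGroup (Fin 2) ℂ,
      Real.circleAverage (fun t => g (t • V)) 0 1 = M) :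
    ∫ y, weight y • g (toDisc (point y)) = (Real.pi ^ 3 / 8) • M := by
  have hint : Integrable fun p : ℝ × E3 => weight (join p) • g (toDisc (point (join p))) :=
    (measurePreserving_join.integrable_comp_emb join.measurableEmbedding).2
      (integrable_weight_smul_toDisc hg)
  rw [← measurePreserving_join.integral_comp', Measure.volume_eq_prod, integral_prod_symm _ hint,
    integral_E3_of_integral_line_eq hint.integral_prod_right (X := (Real.pi ^ 2 / 16) • M),
    smul_smul]
  · congr 1
    ring
  · intro ω hω
    have hmem {v w : ℂ} (hv : v ∈ Metric.sphere (0 : ℂ) 1) (hw : w ∈ Metric.sphere (0 : ℂ) 1) :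
        I • spectralPoint ω v w ∈ Matrix.unitaryGroup (Fin 2) ℂ :=
      smul_mem_unitaryGroup (spectralPoint_mem_unitaryGroup hω hv hw) norm_I
    have hφ : ContinuousOn (Function.uncurry fun v w => g (I • spectralPoint ω v w))
        (Metric.sphere 0 1 ×ˢ Metric.sphere 0 1) :=
      hg.comp (f := fun p : ℂ × ℂ => I • spectralPoint ω p.1 p.2)
        (continuous_spectralPoint.const_smul I).continuousOn fun p hp => hmem hp.1 hp.2
    have hmean : ∀ v ∈ Metric.sphere (0 : ℂ) 1, ∀ w ∈ Metric.sphere (0 : ℂ) 1,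
        Real.circleAverage (fun t => g (I • spectralPoint ω (t * v) (t * w))) 0 1 = M := by
      intro v hv w hw
      simpa only [smul_spectralPoint, mul_left_comm] using hM _ (hmem hv hw)
    obtain ⟨hslice, hvalue⟩ := integral_torusIntegrand_add_sub hφ hmean
    simp only [← integral_smul, sq_smul_weight_smul_toDisc_join hω]
    simp only [integral_smul, hvalue]
    refine ⟨hslice.smul _, ?_⟩
    rw [smul_smul]
    congr 1
    ring

end Poisson

/-! ### The formula at the centre -/

theorem N_one_add_of_mem_minkowski {Z : HC} (hZ : Z ∈ minkowski) :
    N (1 + Z) = star (N (1 - Z)) := by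
  have hZ' : Zᴴ = -Z := hZ
  rw [N, N, ← Matrix.det_conjTranspose, Matrix.conjTranspose_sub, Matrix.conjTranspose_one, hZ',
    sub_neg_eq_add]

/-- The reproducing formula for `F` at the point `W` of the domain `T`, stated in the coordinates
`y` of `𝕄`, in which `dZ⁴ = -4i dy`. -/
structure IsReproducedAt (T : Set HC) (F : HC → ℂ) (W : HC) : Prop where
  integrable : Integrable fun y => extendFrom T F (point y) / N (point y - W) ^ 2
  integral_eq : ∫ y, extendFrom T F (point y) / N (point y - W) ^ 2 = 2 * Real.pi ^ 3 * F W

theorem HasShilovLimits.isReproducedAt_neg_one {F : HC → ℂ}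
    (hF : HasShilovLimits tubePlus discPlus F) : IsReproducedAt tubePlus F (-1) := by
  have hcont : ContinuousOn (fun V => -4 * discForm F V)
      (Matrix.unitaryGroup (Fin 2) ℂ : Set HC) :=
    continuousOn_const.mul ((continuousOn_discForm hF).mono Set.subset_union_right)
  have hmean : ∀ V ∈ Matrix.unitaryGroup (Fin 2) ℂ,
      Real.circleAverage (fun t : ℂ => -4 * discForm F (t • V)) 0 1 = 16 * F (-1) := by
    intro V hV
    have hsmul := Real.circleAverage_fun_smul (a := (-4 : ℂ)) (f := fun t : ℂ => discForm F (t • V))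
      (c := 0) (R := 1)
    simp only [smul_eq_mul, circleAverage_discForm hF hV] at hsmul
    rw [hsmul]
    ring
  have hintegrand (y : Fin 4 → ℝ) : extendFrom tubePlus F (point y) / N (point y - -1) ^ 2 =
      weight y • (-4 * discForm F (toDisc (point y))) := by
    have hN' : N (point y - -1) = star (N (1 - point y)) := by
      rw [sub_neg_eq_add, add_comm, N_one_add_of_mem_minkowski (point_mem_minkowski y)]
    have hsq : (‖N (1 - point y)‖ : ℂ) ^ 2 = N (1 - point y) * star (N (1 - point y)) :=
      (mul_conj' _).symm
    rw [extendFrom_tubePlus_eq hF (point_mem_minkowski y), hN', weight, real_smul, ofReal_inv,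
      ofReal_pow, show 4 = 2 * 2 from rfl, pow_mul, hsq, div_div, mul_pow, inv_mul_eq_div]
  have hint := integrable_weight_smul_toDisc hcont
  have hval := integral_weight_smul_toDisc hcont hmean
  simp only [← hintegrand] at hint hval
  refine ⟨hint, hval.trans ?_⟩
  rw [real_smul]
  push_cast
  ring

/-! ### Affine automorphisms of the tube domain -/

/-- The real affine map `Z ↦ A Z A* + B` of `ℍ_ℂ`; for `N(A) ≠ 0` and `B ∈ 𝕄` it is an automorphism
of `𝕋⁺` and of `𝕄`. -/
def affine (A B Z : HC) : HC := A * Z * Aᴴ + B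

section Affine

variable {A B : HC}

theorem continuous_affine (A B : HC) : Continuous (affine A B) := by
  unfold affine
  fun_prop

open scoped Matrix.Norms.Operator in
theorem differentiable_affine (A B : HC) : Differentiable ℂ (affine A B) := by
  unfold affine
  fun_prop

theorem affine_sub_affine (A B Z W : HC) : affine A B Z - affine A B W = A * (Z - W) * Aᴴ := by
  rw [affine, affine, add_sub_add_right_eq_sub, mul_sub, sub_mul]

theorem affine_add_conjTranspose (A : HC) {B : HC} (hB : B ∈ minkowski) (Z : HC) :
    affine A B Z + (affine A B Z)ᴴ = A * (Z + Zᴴ) * Aᴴ := by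
  have hB' : Bᴴ = -B := hB
  simp only [affine, Matrix.conjTranspose_add, Matrix.conjTranspose_mul,
    Matrix.conjTranspose_conjTranspose, hB']
  noncomm_ring

theorem affine_mem_minkowski (A : HC) (hB : B ∈ minkowski) {Z : HC} (hZ : Z ∈ minkowski) :
    affine A B Z ∈ minkowski := by
  have hZ' : Zᴴ = -Z := hZ
  refine eq_neg_of_add_eq_zero_right ?_
  rw [affine_add_conjTranspose A hB, hZ', add_neg_cancel, mul_zero, zero_mul]

theorem affine_mem_tubePlus (hA : A.det ≠ 0) (hB : B ∈ minkowski) {Z : HC} (hZ : Z ∈ tubePlus) :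
    affine A B Z ∈ tubePlus := by
  have hU : IsUnit A := (Matrix.isUnit_iff_isUnit_det _).2 (isUnit_iff_ne_zero.2 hA)
  rw [mem_tubePlus, affine_add_conjTranspose A hB, ← neg_mul, ← mul_neg,
    ← Matrix.star_eq_conjTranspose A, Matrix.IsUnit.posDef_star_right_conjugate_iff hU]
  exact mem_tubePlus.1 hZ

open scoped MatrixOrder in
theorem exists_affine_neg_one_eq {W : HC} (hW : W ∈ tubePlus) :
    ∃ A : HC, A.det ≠ 0 ∧ ∃ B ∈ minkowski, affine A B (-1) = W := by
  have hpos : ((1 / 2 : ℝ) • -(W + Wᴴ)).PosDef := (mem_tubePlus.1 hW).smul one_half_pos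
  obtain ⟨C, hC⟩ := CStarAlgebra.nonneg_iff_eq_star_mul_self.1 hpos.posSemidef.nonneg
  refine ⟨star C, fun h => hpos.det_pos.ne' ?_, (1 / 2 : ℝ) • (W - Wᴴ), ?_, ?_⟩
  · rw [hC, Matrix.det_mul, h, zero_mul]
  · simp [minkowski, ← smul_neg]
  · rw [affine, Matrix.star_eq_conjTranspose, Matrix.conjTranspose_conjTranspose, mul_neg_one,
      neg_mul, ← Matrix.star_eq_conjTranspose, ← hC]
    module

/-- The denominator of the fractional linear map `toDisc ∘ affine A B ∘ ofDisc`, which is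
`V ↦ i (automNum A B V) (automDen A B V)⁻¹`. -/
noncomputable def automDen (A B V : HC) : HC :=
  (1 - B) * ((Aᴴ)⁻¹ * (V + I • (1 : HC))) - A * (V - I • (1 : HC))

/-- The numerator of the fractional linear map `toDisc ∘ affine A B ∘ ofDisc`, up to the factor
`i`. -/
noncomputable def automNum (A B V : HC) : HC :=
  (1 + B) * ((Aᴴ)⁻¹ * (V + I • (1 : HC))) + A * (V - I • (1 : HC))

theorem continuous_automDen (A B : HC) : Continuous (automDen A B) := by
  unfold automDen
  fun_prop

theorem continuous_automNum (A B : HC) : Continuous (automNum A B) := by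
  unfold automNum
  fun_prop

theorem affine_ofDisc_mul (hA : A.det ≠ 0) {V : HC} (hV : (V + I • (1 : HC)).det ≠ 0) :
    affine A B (ofDisc V) * ((Aᴴ)⁻¹ * (V + I • (1 : HC))) =
      A * (V - I • (1 : HC)) + B * ((Aᴴ)⁻¹ * (V + I • (1 : HC))) := by
  have hA' : IsUnit Aᴴ.det := by rwa [isUnit_iff_ne_zero, Matrix.det_conjTranspose, star_ne_zero]
  rw [affine, add_mul, mul_assoc (A * _), Matrix.mul_nonsing_inv_cancel_left _ _ hA', mul_assoc A,
    ofDisc_mul_add_I hV]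

theorem one_sub_affine_ofDisc_mul (hA : A.det ≠ 0) {V : HC} (hV : (V + I • (1 : HC)).det ≠ 0) :
    (1 - affine A B (ofDisc V)) * ((Aᴴ)⁻¹ * (V + I • (1 : HC))) = automDen A B V := by
  rw [sub_mul, one_mul, affine_ofDisc_mul hA hV, automDen, sub_mul, one_mul,
    add_comm (A * _), sub_add_eq_sub_sub]

theorem one_add_affine_ofDisc_mul (hA : A.det ≠ 0) {V : HC} (hV : (V + I • (1 : HC)).det ≠ 0) :
    (1 + affine A B (ofDisc V)) * ((Aᴴ)⁻¹ * (V + I • (1 : HC))) = automNum A B V := by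
  rw [add_mul, one_mul, affine_ofDisc_mul hA hV, automNum, add_mul, one_mul, add_assoc,
    add_comm (B * _)]

theorem toDisc_affine_ofDisc (hA : A.det ≠ 0) {V : HC} (hV : (V + I • (1 : HC)).det ≠ 0) :
    toDisc (affine A B (ofDisc V)) = I • (automNum A B V * (automDen A B V)⁻¹) := by
  have hP : IsUnit ((Aᴴ)⁻¹ * (V + I • (1 : HC))) := by
    refine IsUnit.mul ?_ ((Matrix.isUnit_iff_isUnit_det _).2 (isUnit_iff_ne_zero.2 hV))
    rw [Matrix.isUnit_nonsing_inv_iff, Matrix.isUnit_iff_isUnit_det, isUnit_iff_ne_zero,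
      Matrix.det_conjTranspose, star_ne_zero]
    exact hA
  rw [toDisc, ← one_add_affine_ofDisc_mul hA hV, ← one_sub_affine_ofDisc_mul hA hV,
    Matrix.mul_inv_rev, mul_assoc, Matrix.mul_nonsing_inv_cancel_left]
  exact (Matrix.isUnit_iff_isUnit_det _).1 hP

theorem rho1_cayley_inv_comp_affine (F : HC → ℂ) (hA : A.det ≠ 0) {V : HC}
    (hV : (V + I • (1 : HC)).det ≠ 0) (hαV : (1 - affine A B (ofDisc V)).det ≠ 0) :
    rho1 cayley⁻¹ (F ∘ affine A B) V =
      16 * rho1 cayley⁻¹ F (I • (automNum A B V * (automDen A B V)⁻¹)) /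
        (N Aᴴ * N (automDen A B V)) ^ 2 := by
  have hA' : N Aᴴ ≠ 0 := by rwa [N, Matrix.det_conjTranspose, star_ne_zero]
  have hden : N Aᴴ * N (automDen A B V) =
      N (1 - affine A B (ofDisc V)) * N (V + I • (1 : HC)) := by
    rw [← one_sub_affine_ofDisc_mul hA hV]
    simp only [N, Matrix.det_mul, Matrix.det_nonsing_inv, Ring.inverse_eq_inv'] at hA' ⊢
    rw [mul_left_comm, mul_inv_cancel_left₀ hA']
  rw [rho1_cayley_inv, ← ofDisc, Function.comp_apply, eq_rho1_cayley_inv_toDisc F hαV,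
    toDisc_affine_ofDisc hA hV, hden]
  ring

theorem automDen_gram (hA : A.det ≠ 0) (hB : B ∈ minkowski) (V : HC) :
    (automDen A B V)ᴴ * automDen A B V - (automNum A B V)ᴴ * automNum A B V =
      (4 : ℂ) • (1 - Vᴴ * V) := by
  have hB' : Bᴴ = -B := hB
  have hA' : IsUnit A.det := isUnit_iff_ne_zero.2 hA
  have hcancel (X Y : HC) : ((Aᴴ)⁻¹ * X)ᴴ * (A * Y) = Xᴴ * Y := by
    rw [Matrix.conjTranspose_mul, Matrix.conjTranspose_nonsing_inv,
      Matrix.conjTranspose_conjTranspose, mul_assoc, Matrix.nonsing_inv_mul_cancel_left _ _ hA']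
  have hcancel' (X Y : HC) : (A * Y)ᴴ * ((Aᴴ)⁻¹ * X) = Yᴴ * X := by
    simpa using congrArg Matrix.conjTranspose (hcancel X Y)
  calc _ = (-2 : ℂ) • (((Aᴴ)⁻¹ * (V + I • (1 : HC)))ᴴ * (A * (V - I • (1 : HC))) +
          (A * (V - I • (1 : HC)))ᴴ * ((Aᴴ)⁻¹ * (V + I • (1 : HC)))) := by
        rw [automDen, automNum]
        generalize (Aᴴ)⁻¹ * (V + I • (1 : HC)) = P, A * (V - I • (1 : HC)) = Q
        simp only [Matrix.conjTranspose_add, Matrix.conjTranspose_sub, Matrix.conjTranspose_mul,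
          hB', mul_add, add_mul, sub_mul, mul_sub, mul_neg, neg_mul, one_mul, mul_assoc]
        module
    _ = (-2 : ℂ) • ((V + I • (1 : HC))ᴴ * (V - I • (1 : HC)) +
          (V - I • (1 : HC))ᴴ * (V + I • (1 : HC))) := by rw [hcancel, hcancel']
    _ = _ := by
        simp only [Matrix.conjTranspose_add, Matrix.conjTranspose_sub, Matrix.conjTranspose_smul,
          Matrix.conjTranspose_one, RCLike.star_def, conj_I, mul_add, add_mul, sub_mul, mul_sub,
          smul_mul_assoc, mul_smul_comm, one_mul, mul_one, smul_add, smul_sub, smul_smul, mul_neg,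
          I_mul_I]
        module

theorem det_automDen_ne_zero (hA : A.det ≠ 0) (hB : B ∈ minkowski) {V : HC}
    (hV : V ∈ Matrix.unitaryGroup (Fin 2) ℂ) : (automDen A B V).det ≠ 0 := by
  have hA' : IsUnit A.det := isUnit_iff_ne_zero.2 hA
  have hAH : IsUnit Aᴴ.det := by rwa [isUnit_iff_ne_zero, Matrix.det_conjTranspose, star_ne_zero]
  have hgram := automDen_gram hA hB V
  rw [← Matrix.star_eq_conjTranspose V, Matrix.mem_unitaryGroup_iff'.1 hV, sub_self, smul_zero,
    sub_eq_zero] at hgram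
  have hcomb : (Aᴴ - A⁻¹ * (1 - B)) * automNum A B V + (Aᴴ + A⁻¹ * (1 + B)) * automDen A B V =
      (4 * I) • (1 : HC) := by
    calc _ = (2 : ℂ) • (Aᴴ * ((Aᴴ)⁻¹ * (V + I • (1 : HC))) -
          A⁻¹ * (A * (V - I • (1 : HC)))) := by
          rw [automDen, automNum]
          generalize (Aᴴ)⁻¹ * (V + I • (1 : HC)) = P, A * (V - I • (1 : HC)) = Q
          simp only [mul_add, add_mul, sub_mul, mul_sub, one_mul, mul_one, mul_assoc]
          module
      _ = _ := by
          rw [Matrix.mul_nonsing_inv_cancel_left _ _ hAH,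
            Matrix.nonsing_inv_mul_cancel_left _ _ hA']
          module
  intro h0
  obtain ⟨v, hv, hden⟩ := Matrix.exists_mulVec_eq_zero_iff.2 h0
  have hnum : automNum A B V *ᵥ v = 0 := by
    rw [← Matrix.conjTranspose_mul_self_mulVec_eq_zero, ← hgram, ← Matrix.mulVec_mulVec, hden,
      Matrix.mulVec_zero]
  have h := congrArg (· *ᵥ v) hcomb
  simp only [Matrix.add_mulVec, ← Matrix.mulVec_mulVec, hnum, hden, Matrix.mulVec_zero, add_zero,
    Matrix.smul_mulVec, Matrix.one_mulVec] at h
  exact hv ((smul_eq_zero.1 h.symm).resolve_left (by simp))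

theorem smul_automNum_mul_automDen_inv_mem_unitaryGroup (hA : A.det ≠ 0) (hB : B ∈ minkowski)
    {V : HC} (hV : V ∈ Matrix.unitaryGroup (Fin 2) ℂ) :
    I • (automNum A B V * (automDen A B V)⁻¹) ∈ Matrix.unitaryGroup (Fin 2) ℂ := by
  refine smul_mem_unitaryGroup (Matrix.mem_unitaryGroup_iff'.2 ?_) norm_I
  have hden : IsUnit (automDen A B V).det := isUnit_iff_ne_zero.2 (det_automDen_ne_zero hA hB hV)
  have hgram := automDen_gram hA hB V
  rw [← Matrix.star_eq_conjTranspose V, Matrix.mem_unitaryGroup_iff'.1 hV, sub_self, smul_zero,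
    sub_eq_zero] at hgram
  rw [star_mul, Matrix.star_eq_conjTranspose (automNum A B V), mul_assoc, ← mul_assoc _ᴴ, ← hgram,
    mul_assoc _ᴴ, Matrix.mul_nonsing_inv _ hden, mul_one, ← Matrix.star_eq_conjTranspose,
    ← star_mul, Matrix.mul_nonsing_inv _ hden, star_one]

open scoped Matrix.Norms.Operator in
theorem HasShilovLimits.comp_affine {F : HC → ℂ} (hF : HasShilovLimits tubePlus discPlus F)
    (hA : A.det ≠ 0) (hB : B ∈ minkowski) :
    HasShilovLimits tubePlus discPlus (F ∘ affine A B) where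
  differentiableOn := hF.differentiableOn.comp (differentiable_affine A B).differentiableOn
    fun Z hZ => affine_mem_tubePlus hA hB hZ
  exists_tendsto V hV := by
    have hden := det_automDen_ne_zero hA hB hV
    obtain ⟨c, hc⟩ :=
      hF.exists_tendsto _ (smul_automNum_mul_automDen_inv_mem_unitaryGroup hA hB hV)
    have hmaps : ∀ U ∈ discPlus, affine A B (ofDisc U) ∈ tubePlus := fun U hU =>
      affine_mem_tubePlus hA hB (ofDisc_mem_tubePlus hU)
    have hautom : Tendsto (fun U => I • (automNum A B U * (automDen A B U)⁻¹)) (𝓝[discPlus] V)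
        (𝓝[discPlus] (I • (automNum A B V * (automDen A B V)⁻¹))) := by
      refine tendsto_nhdsWithin_iff.2 ⟨?_, eventually_nhdsWithin_of_forall fun U hU => ?_⟩
      · have hinv := (continuousAt_matrix_inv hden).comp (continuous_automDen A B).continuousAt
        exact (((continuous_automNum A B).continuousAt.mul hinv).const_smul I).mono_left
          nhdsWithin_le_nhds
      · rw [← toDisc_affine_ofDisc hA (det_add_I_ne_zero_of_mem_discPlus hU)]
        exact toDisc_mem_discPlus (hmaps U hU)
    have hN : Tendsto (fun U => (N Aᴴ * N (automDen A B U)) ^ 2) (𝓝[discPlus] V)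
        (𝓝 ((N Aᴴ * N (automDen A B V)) ^ 2)) :=
      (((continuous_const.mul (continuous_N.comp (continuous_automDen A B))).pow 2).tendsto
        V).mono_left nhdsWithin_le_nhds
    have hA' : N Aᴴ ≠ 0 := by rwa [N, Matrix.det_conjTranspose, star_ne_zero]
    refine ⟨_, (((hc.comp hautom).const_mul 16).div hN
      (pow_ne_zero 2 (mul_ne_zero hA' hden))).congr' ?_⟩
    exact eventually_nhdsWithin_of_forall fun U hU => (rho1_cayley_inv_comp_affine F hA
      (det_add_I_ne_zero_of_mem_discPlus hU)
      (det_one_sub_ne_zero_of_mem_tubePlus (hmaps U hU))).symm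

theorem extendFrom_comp_affine {F : HC → ℂ} (hF : HasShilovLimits tubePlus discPlus F)
    (hA : A.det ≠ 0) (hB : B ∈ minkowski) {Z : HC} (hZ : Z ∈ minkowski) :
    extendFrom tubePlus (F ∘ affine A B) Z = extendFrom tubePlus F (affine A B Z) := by
  have hlim := tendsto_extendFrom ⟨_, tendsto_nhdsWithin_tubePlus hF (affine_mem_minkowski A hB hZ)⟩
  refine extendFrom_eq (minkowski_subset_closure_tubePlus hZ) (hlim.comp ?_)
  exact tendsto_nhdsWithin_iff.2 ⟨(continuous_affine A B).continuousAt.mono_left nhdsWithin_le_nhds,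
    eventually_nhdsWithin_of_forall fun Z hZ => affine_mem_tubePlus hA hB hZ⟩

end Affine

/-! ### Change of variables -/

theorem dZ4_mul_left (A : HC) (v : Fin 4 → HC) : dZ4 (fun k => A * v k) = N A ^ 2 * dZ4 v := by
  have hcoord : (Matrix.of fun k => ![(A * v k) 0 0, (A * v k) 0 1, (A * v k) 1 0, (A * v k) 1 1]) =
      (Matrix.of fun k => ![v k 0 0, v k 0 1, v k 1 0, v k 1 1]) *
        !![A 0 0, 0, A 1 0, 0; 0, A 0 0, 0, A 1 0; A 0 1, 0, A 1 1, 0; 0, A 0 1, 0, A 1 1] := by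
    ext k l
    fin_cases l <;> simp [Matrix.mul_apply, Fin.sum_univ_four] <;> ring
  rw [dZ4, hcoord, Matrix.det_mul, mul_comm, ← dZ4]
  congr 1
  simp [N, Matrix.det_succ_row_zero, Fin.sum_univ_succ, Fin.succAbove]
  ring

theorem dZ4_mul_right (A : HC) (v : Fin 4 → HC) : dZ4 (fun k => v k * A) = N A ^ 2 * dZ4 v := by
  have hcoord : (Matrix.of fun k => ![(v k * A) 0 0, (v k * A) 0 1, (v k * A) 1 0, (v k * A) 1 1]) =
      (Matrix.of fun k => ![v k 0 0, v k 0 1, v k 1 0, v k 1 1]) *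
        !![A 0 0, A 0 1, 0, 0; A 1 0, A 1 1, 0, 0; 0, 0, A 0 0, A 0 1; 0, 0, A 1 0, A 1 1] := by
    ext k l
    fin_cases l <;> simp [Matrix.mul_apply, Fin.sum_univ_four]
  rw [dZ4, hcoord, Matrix.det_mul, mul_comm, ← dZ4]
  congr 1
  simp [N, Matrix.det_succ_row_zero, Fin.sum_univ_succ, Fin.succAbove]
  ring

theorem dZ4_point (L : Fin 4 → Fin 4 → ℝ) :
    dZ4 (fun k => point (L k)) = (Matrix.of L).det * dZ4 basis := by
  have hcoord : (Matrix.of fun k =>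
      ![point (L k) 0 0, point (L k) 0 1, point (L k) 1 0, point (L k) 1 1]) =
      (Matrix.of L).map ofReal *
        Matrix.of fun k => ![basis k 0 0, basis k 0 1, basis k 1 0, basis k 1 1] := by
    ext k l
    fin_cases l <;> simp [point, Matrix.mul_apply, Fin.sum_univ_four]
  rw [dZ4, hcoord, Matrix.det_mul, ← dZ4]
  congr 1
  exact (RingHom.map_det ofRealHom _).symm

theorem exists_affine_point_eq (A : HC) {B : HC} (hB : B ∈ minkowski) :
    ∃ (M : Matrix (Fin 4) (Fin 4) ℝ) (b : Fin 4 → ℝ), M.det = ‖N A‖ ^ 4 ∧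
      ∀ y, affine A B (point y) = point (M *ᵥ y + b) := by
  have hbasis (k : Fin 4) : A * basis k * Aᴴ ∈ minkowski := by
    have hk : basis k ∈ minkowski := by
      simpa [point, Pi.single_apply] using point_mem_minkowski (Pi.single k 1)
    simpa [affine] using affine_mem_minkowski A (B := 0) (by simp [minkowski]) hk
  simp only [← range_point, Set.mem_range] at hbasis hB
  choose L hL using hbasis
  obtain ⟨b, rfl⟩ := hB
  refine ⟨(Matrix.of L)ᵀ, b, ?_, fun y => ?_⟩
  · have hstar : star (N A) = N Aᴴ := (Matrix.det_conjTranspose A).symm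
    have hdet : ((Matrix.of L).det : ℂ) * dZ4 basis = (N A * star (N A)) ^ 2 * dZ4 basis := by
      rw [← dZ4_point, mul_pow, mul_assoc, hstar, ← dZ4_mul_right, ← dZ4_mul_left]
      simp only [hL, mul_assoc]
    have hbasis_ne : dZ4 basis ≠ 0 := by simp [dZ4_basis]
    have hnorm : ((Matrix.of L).det : ℂ) = ((‖N A‖ ^ 4 : ℝ) : ℂ) := by
      rw [mul_right_cancel₀ hbasis_ne hdet, RCLike.star_def, mul_conj']
      push_cast
      ring
    rw [Matrix.det_transpose]
    exact_mod_cast hnorm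
  · have hsum : A * point y * Aᴴ = ∑ k, (y k : ℂ) • point (L k) := by
      simp only [hL]
      rw [point, Matrix.mul_sum, Matrix.sum_mul]
      simp only [mul_smul_comm, smul_mul_assoc]
    have hlin : ∑ k, (y k : ℂ) • point (L k) = point ((Matrix.of L)ᵀ *ᵥ y) := by
      simp only [point, Matrix.mulVec, dotProduct, Matrix.transpose_apply, Matrix.of_apply,
        ofReal_sum, ofReal_mul, Finset.sum_smul, Finset.smul_sum, smul_smul, mul_comm]
      exact Finset.sum_comm
    rw [affine, hsum, hlin]
    simp only [point, Pi.add_apply, ofReal_add, add_smul, Finset.sum_add_distrib]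

section AffineChangeOfVariables

variable {ι E : Type*} [Fintype ι] [DecidableEq ι] [NormedAddCommGroup E] {M : Matrix ι ι ℝ}

theorem measurableEmbedding_toLin' (hM : M.det ≠ 0) : MeasurableEmbedding (Matrix.toLin' M) := by
  have hinj : Function.Injective (Matrix.toLin' M) :=
    Matrix.mulVec_injective_iff_isUnit.2
      ((Matrix.isUnit_iff_isUnit_det M).2 (isUnit_iff_ne_zero.2 hM))
  exact (LinearMap.continuous_of_finiteDimensional _).measurableEmbedding hinj

theorem integrable_comp_mulVec_add_iff (hM : M.det ≠ 0) (b : ι → ℝ) (g : (ι → ℝ) → E) :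
    Integrable (fun y => g (M *ᵥ y + b)) ↔ Integrable g := by
  have hne : ENNReal.ofReal |M.det⁻¹| ≠ 0 := by simp [hM]
  have hadd : Integrable (fun y => g (y + b)) ↔ Integrable g :=
    (measurePreserving_add_right volume b).integrable_comp_emb (measurableEmbedding_addRight b)
  rw [← hadd, ← integrable_smul_measure (f := fun y => g (y + b)) hne ENNReal.ofReal_ne_top,
    ← Real.map_matrix_volume_pi_eq_smul_volume_pi hM,
    (measurableEmbedding_toLin' hM).integrable_map_iff]
  rfl

theorem integral_comp_mulVec_add [NormedSpace ℝ E] (hM : M.det ≠ 0) (b : ι → ℝ)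
    (g : (ι → ℝ) → E) : ∫ y, g (M *ᵥ y + b) = |M.det|⁻¹ • ∫ y, g y := by
  have hmap := (measurableEmbedding_toLin' hM).integral_map (μ := volume) fun y => g (y + b)
  rw [Real.map_matrix_volume_pi_eq_smul_volume_pi hM, integral_smul_measure,
    integral_add_right_eq_self, ENNReal.toReal_ofReal (abs_nonneg _), abs_inv] at hmap
  exact hmap.symm

end AffineChangeOfVariables

theorem HasShilovLimits.isReproducedAt {F : HC → ℂ} (hF : HasShilovLimits tubePlus discPlus F)
    {W : HC} (hW : W ∈ tubePlus) : IsReproducedAt tubePlus F W := by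
  obtain ⟨A, hA, B, hB, rfl⟩ := exists_affine_neg_one_eq hW
  obtain ⟨M, b, hdet, hM⟩ := exists_affine_point_eq A hB
  have hA' : ‖N A‖ ^ 4 ≠ 0 := pow_ne_zero 4 (norm_ne_zero_iff.2 hA)
  have hM0 : M.det ≠ 0 := hdet ▸ hA'
  set g : (Fin 4 → ℝ) → ℂ := fun y =>
    extendFrom tubePlus F (point y) / N (point y - affine A B (-1)) ^ 2 with hg
  have hN (Z : HC) : N (affine A B Z - affine A B (-1)) = ‖N A‖ ^ 2 * N (Z - -1) := by
    rw [affine_sub_affine, N, Matrix.det_mul, Matrix.det_mul, Matrix.det_conjTranspose, ← N, ← N,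
      mul_right_comm, RCLike.star_def, mul_conj']
  have hcomp (y : Fin 4 → ℝ) : ((‖N A‖ ^ 4 : ℝ) : ℂ) * g (M *ᵥ y + b) =
      extendFrom tubePlus (F ∘ affine A B) (point y) / N (point y - -1) ^ 2 := by
    simp only [hg]
    rw [← hM, hN, extendFrom_comp_affine hF hA hB (point_mem_minkowski y)]
    have := ofReal_ne_zero.2 hA'
    push_cast at this ⊢
    rw [mul_pow, ← pow_mul, ← mul_div_assoc, mul_div_mul_left _ _ this]
  obtain ⟨hint, hval⟩ := (hF.comp_affine hA hB).isReproducedAt_neg_one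
  simp only [← hcomp] at hint hval
  constructor
  · rw [← integrable_comp_mulVec_add_iff hM0 b]
    exact (integrable_const_mul_iff (isUnit_iff_ne_zero.2 (ofReal_ne_zero.2 hA')) _).1 hint
  · rw [integral_const_mul, integral_comp_mulVec_add hM0 b, hdet, abs_of_nonneg (by positivity),
      ← real_smul, smul_inv_smul₀ hA'] at hval
    exact hval

/-! ### The opposite tube domain -/

theorem neg_inv_add_I {V : HC} (hV : V.det ≠ 0) :
    -V⁻¹ + I • (1 : HC) = (V + I • (1 : HC)) * (I • V⁻¹) := by
  rw [add_mul, mul_smul_comm, Matrix.mul_nonsing_inv V (isUnit_iff_ne_zero.2 hV),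
    smul_mul_smul_comm, I_mul_I, one_mul, neg_one_smul, add_comm]

theorem ofDisc_neg_inv {V : HC} (hV : V.det ≠ 0) (hVI : (V + I • (1 : HC)).det ≠ 0) :
    ofDisc (-V⁻¹) = -ofDisc V := by
  have hadd := neg_inv_add_I hV
  have hsub : -V⁻¹ - I • (1 : HC) = -(V - I • (1 : HC)) * (I • V⁻¹) := by
    rw [neg_mul, sub_mul, mul_smul_comm, Matrix.mul_nonsing_inv V (isUnit_iff_ne_zero.2 hV),
      smul_mul_smul_comm, I_mul_I, one_mul, neg_one_smul]
    abel
  have hunit : IsUnit (-V⁻¹ + I • (1 : HC)).det := by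
    rw [hadd, Matrix.det_mul, Matrix.det_smul, Matrix.det_nonsing_inv, Ring.inverse_eq_inv']
    exact isUnit_iff_ne_zero.2
      (mul_ne_zero hVI (mul_ne_zero (pow_ne_zero _ I_ne_zero) (inv_ne_zero hV)))
  rw [ofDisc, hsub, ← ofDisc_mul_add_I hVI, ← neg_mul, mul_assoc (-ofDisc V), ← hadd,
    Matrix.mul_nonsing_inv_cancel_right _ _ hunit]

theorem rho1_cayley_inv_comp_neg (F : HC → ℂ) {V : HC} (hV : V.det ≠ 0)
    (hVI : (V + I • (1 : HC)).det ≠ 0) :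
    rho1 cayley⁻¹ (F ∘ Neg.neg) V = rho1 cayley⁻¹ F (-V⁻¹) / N V ^ 2 := by
  have hN : N (-V⁻¹ + I • (1 : HC)) = -(N (V + I • (1 : HC)) / N V) := by
    rw [neg_inv_add_I hV, N, Matrix.det_mul, Matrix.det_smul, Matrix.det_nonsing_inv,
      Ring.inverse_eq_inv', Fintype.card_fin, I_sq, N, N, neg_one_mul, mul_neg, div_eq_mul_inv]
  have hNV : N V ≠ 0 := hV
  have hNVI : N (V + I • (1 : HC)) ≠ 0 := hVI
  rw [rho1_cayley_inv, rho1_cayley_inv, ← ofDisc, ← ofDisc, ofDisc_neg_inv hV hVI, hN,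
    Function.comp_apply]
  field_simp

theorem neg_inv_mem_discMinus {V : HC} (hV : V ∈ discPlus) (hdet : V.det ≠ 0) :
    -V⁻¹ ∈ discMinus := by
  have hinv : V * V⁻¹ = 1 := Matrix.mul_nonsing_inv _ (isUnit_iff_ne_zero.2 hdet)
  have hU : IsUnit V := (Matrix.isUnit_iff_isUnit_det _).2 (isUnit_iff_ne_zero.2 hdet)
  refine (Matrix.IsUnit.posDef_star_right_conjugate_iff hU).1 ?_
  have hgram : V * (V⁻¹ * V⁻¹ᴴ) * Vᴴ = 1 := by
    rw [← mul_assoc, hinv, one_mul, ← Matrix.conjTranspose_mul, hinv, Matrix.conjTranspose_one]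
  rw [Matrix.star_eq_conjTranspose, Matrix.conjTranspose_neg, neg_mul_neg, mul_sub, sub_mul, hgram,
    mul_one]
  exact hV

theorem tendsto_neg_inv_nhdsWithin_discMinus {V : HC} (hV : V.det ≠ 0) :
    Tendsto (fun V : HC => -V⁻¹) (𝓝[discPlus] V) (𝓝[discMinus] (-V⁻¹)) := by
  refine tendsto_nhdsWithin_iff.2
    ⟨(continuousAt_matrix_inv hV).neg.mono_left nhdsWithin_le_nhds, ?_⟩
  filter_upwards [self_mem_nhdsWithin,
    nhdsWithin_le_nhds (continuous_N.continuousAt.eventually_ne hV)] with V' hV' hdet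
  exact neg_inv_mem_discMinus hV' hdet

theorem tendsto_neg_nhdsWithin_tubeMinus (Z : HC) :
    Tendsto Neg.neg (𝓝[tubeMinus] Z) (𝓝[tubePlus] (-Z)) :=
  tendsto_nhdsWithin_iff.2 ⟨(continuous_neg.tendsto Z).mono_left nhdsWithin_le_nhds,
    eventually_nhdsWithin_of_forall fun _ => mem_tubeMinus.1⟩

open scoped Matrix.Norms.Operator in
theorem HasShilovLimits.comp_neg {F : HC → ℂ} (hF : HasShilovLimits tubeMinus discMinus F) :
    HasShilovLimits tubePlus discPlus (F ∘ Neg.neg) := by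
  refine ⟨hF.differentiableOn.comp (by fun_prop) fun Z hZ => mem_tubeMinus.2 (by rwa [neg_neg]),
    fun V hV => ?_⟩
  have hinv : V⁻¹ = star V := Matrix.inv_eq_right_inv (Matrix.mem_unitaryGroup_iff.1 hV)
  have hdet : V.det ≠ 0 :=
    (Matrix.isUnit_det_of_right_inverse (Matrix.mem_unitaryGroup_iff.1 hV)).ne_zero
  have hmem : -V⁻¹ ∈ Matrix.unitaryGroup (Fin 2) ℂ := by
    rw [hinv, Matrix.mem_unitaryGroup_iff, star_neg, star_star, neg_mul_neg]
    exact Matrix.mem_unitaryGroup_iff'.1 hV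
  obtain ⟨c, hc⟩ := hF.exists_tendsto _ hmem
  have hN : Tendsto (fun V => N V ^ 2) (𝓝[discPlus] V) (𝓝 (N V ^ 2)) :=
    ((continuous_N.pow 2).tendsto V).mono_left nhdsWithin_le_nhds
  refine ⟨c / N V ^ 2, ((hc.comp (tendsto_neg_inv_nhdsWithin_discMinus hdet)).div hN
    (pow_ne_zero 2 hdet)).congr' ?_⟩
  filter_upwards [self_mem_nhdsWithin,
    nhdsWithin_le_nhds (continuous_N.continuousAt.eventually_ne hdet)] with V' hV' hdet'
  exact (rho1_cayley_inv_comp_neg F hdet' (det_add_I_ne_zero_of_mem_discPlus hV')).symm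

theorem tendsto_nhdsWithin_tubeMinus {F : HC → ℂ} (hF : HasShilovLimits tubeMinus discMinus F)
    {Z : HC} (hZ : Z ∈ minkowski) :
    Tendsto F (𝓝[tubeMinus] Z) (𝓝 (extendFrom tubePlus (F ∘ Neg.neg) (-Z))) := by
  have hZ' := neg_mem_minkowski.2 hZ
  rw [extendFrom_tubePlus_eq hF.comp_neg hZ']
  simpa only [Function.comp_def, neg_neg] using
    (tendsto_nhdsWithin_tubePlus hF.comp_neg hZ').comp (tendsto_neg_nhdsWithin_tubeMinus Z)

theorem HasShilovLimits.isReproducedAt_tubeMinus {F : HC → ℂ}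
    (hF : HasShilovLimits tubeMinus discMinus F) {W : HC} (hW : W ∈ tubeMinus) :
    IsReproducedAt tubeMinus F W := by
  obtain ⟨hint, hval⟩ := hF.comp_neg.isReproducedAt (mem_tubeMinus.1 hW)
  have hneg (y : Fin 4 → ℝ) : extendFrom tubeMinus F (point y) / N (point y - W) ^ 2 =
      extendFrom tubePlus (F ∘ Neg.neg) (point (-y)) / N (point (-y) - -W) ^ 2 := by
    have hpoint : point (-y) = -point y := by simp [point]
    have hN : N (-point y - -W) = N (point y - W) := by
      rw [← neg_sub', N, Matrix.det_neg, N]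
      simp
    have hy := point_mem_minkowski y
    rw [extendFrom_eq (minkowski_subset_closure_tubeMinus hy) (tendsto_nhdsWithin_tubeMinus hF hy),
      hpoint, hN]
  constructor
  · simpa only [hneg] using hint.comp_neg
  · simp only [hneg]
    rw [integral_neg_eq_self fun y =>
      extendFrom tubePlus (F ∘ Neg.neg) (point y) / N (point y - -W) ^ 2, hval,
      Function.comp_apply, neg_neg]

/-- The conclusion of the reproducing formula for `F` on the tube domain `T`: the boundary values of
`F` on `𝕄`, denoted `extendFrom T F`, exist, and `F` is recovered from them by absolutely convergent
integrals. -/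
def IsReproducedOn (T : Set HC) (F : HC → ℂ) : Prop :=
  (∀ Z ∈ minkowski, Tendsto F (𝓝[T] Z) (𝓝 (extendFrom T F Z))) ∧
    ∀ W ∈ T, IntegrableM (fun Z => extendFrom T F Z / N (Z - W) ^ 2) ∧
      F W = pairing (extendFrom T F) (fun Z => 1 / N (Z - W) ^ 2) ∧
      F W = I / (8 * (Real.pi : ℂ) ^ 3) * integralM (fun Z => extendFrom T F Z / N (Z - W) ^ 2)

theorem IsReproducedAt.eq_integralM {T : Set HC} {F : HC → ℂ} {W : HC}
    (h : IsReproducedAt T F W) :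
    F W = I / (8 * (Real.pi : ℂ) ^ 3) *
      integralM (fun Z => extendFrom T F Z / N (Z - W) ^ 2) := by
  have hpi : (Real.pi : ℂ) ≠ 0 := ofReal_ne_zero.2 Real.pi_ne_zero
  rw [integralM, integral_mul_const, h.integral_eq, dZ4_basis]
  field_simp
  linear_combination (8 : ℂ) * F W * I_sq

theorem isReproducedOn_of_tendsto {T : Set HC} {F : HC → ℂ}
    (hlim : ∀ Z ∈ minkowski, ∃ c, Tendsto F (𝓝[T] Z) (𝓝 c))
    (hW : ∀ W ∈ T, IsReproducedAt T F W) : IsReproducedOn T F := by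
  refine ⟨fun Z hZ => tendsto_extendFrom (hlim Z hZ), fun W hWT => ?_⟩
  refine ⟨(hW W hWT).integrable.mul_const _, ?_, (hW W hWT).eq_integralM⟩
  simpa only [pairing, mul_one_div] using (hW W hWT).eq_integralM

theorem exists_tendsto_of_eqOn {X Y : Type*} [TopologicalSpace X] [TopologicalSpace Y]
    {D U : Set X} {f G : X → Y} {x : X} (hU : IsOpen U) (hDU : closure D ⊆ U)
    (hG : ContinuousOn G U) (hGf : Set.EqOn G f D) (hx : x ∈ closure D) :
    ∃ c, Tendsto f (𝓝[D] x) (𝓝 c) := by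
  refine ⟨G x, Tendsto.congr' (eventually_nhdsWithin_of_forall hGf) ?_⟩
  exact (hG.continuousAt (hU.mem_nhds (hDU hx))).mono_left nhdsWithin_le_nhds

open scoped Matrix.Norms.Operator in
theorem hasShilovLimits_of_mem_ZhPlus {F : HC → ℂ} (hF : F ∈ ZhPlus) :
    HasShilovLimits tubePlus discPlus F := by
  obtain ⟨hd, U, hU, hDU, G, hG, hGF⟩ := hF
  exact ⟨hd, fun V hV => exists_tendsto_of_eqOn hU hDU hG.continuousOn hGF
    (unitaryGroup_subset_closure_discPlus hV)⟩

open scoped Matrix.Norms.Operator in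
theorem hasShilovLimits_of_mem_ZhMinus {F : HC → ℂ} (hF : F ∈ ZhMinus) :
    HasShilovLimits tubeMinus discMinus F := by
  obtain ⟨hd, U, hU, hDU, G, hG, hGF, -⟩ := hF
  exact ⟨hd, fun V hV => exists_tendsto_of_eqOn hU hDU hG.continuousOn hGF
    (unitaryGroup_subset_closure_discMinus hV)⟩

end HC

theorem mainTheorem11_general :
    (∀ F, HC.HasShilovLimits HC.tubePlus HC.discPlus F → HC.IsReproducedOn HC.tubePlus F) ∧
    (∀ F, HC.HasShilovLimits HC.tubeMinus HC.discMinus F → HC.IsReproducedOn HC.tubeMinus F) :=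
  ⟨fun _ hF => HC.isReproducedOn_of_tendsto
      (fun _ hZ => ⟨_, HC.tendsto_nhdsWithin_tubePlus hF hZ⟩)
      fun _ hW => hF.isReproducedAt hW,
    fun _ hF => HC.isReproducedOn_of_tendsto
      (fun _ hZ => ⟨_, HC.tendsto_nhdsWithin_tubeMinus hF hZ⟩)
      fun _ hW => hF.isReproducedAt_tubeMinus hW⟩

/-- The values on Minkowski space of a function on a tube domain are its boundary values, that is
its limits from within the tube domain. -/
theorem mainTheorem11 :
    (∀ F ∈ HC.ZhPlus,
      (∀ Z ∈ HC.minkowski, Filter.Tendsto F (nhdsWithin Z HC.tubePlus)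
        (nhds (extendFrom HC.tubePlus F Z))) ∧
      ∀ W ∈ HC.tubePlus,
        HC.IntegrableM (fun Z => extendFrom HC.tubePlus F Z / HC.N (Z - W) ^ 2) ∧
        F W = HC.pairing (extendFrom HC.tubePlus F) (fun Z => 1 / HC.N (Z - W) ^ 2) ∧
        F W = Complex.I / (8 * (Real.pi : ℂ) ^ 3) *
          HC.integralM (fun Z => extendFrom HC.tubePlus F Z / HC.N (Z - W) ^ 2)) ∧
    (∀ F ∈ HC.ZhMinus,
      (∀ Z ∈ HC.minkowski, Filter.Tendsto F (nhdsWithin Z HC.tubeMinus)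
        (nhds (extendFrom HC.tubeMinus F Z))) ∧
      ∀ W ∈ HC.tubeMinus,
        HC.IntegrableM (fun Z => extendFrom HC.tubeMinus F Z / HC.N (Z - W) ^ 2) ∧
        F W = HC.pairing (extendFrom HC.tubeMinus F) (fun Z => 1 / HC.N (Z - W) ^ 2) ∧
        F W = Complex.I / (8 * (Real.pi : ℂ) ^ 3) *
          HC.integralM (fun Z => extendFrom HC.tubeMinus F Z / HC.N (Z - W) ^ 2)) :=
  ⟨fun F hF => mainTheorem11_general.1 F (HC.hasShilovLimits_of_mem_ZhPlus hF),
    fun F hF => mainTheorem11_general.2 F (HC.hasShilovLimits_of_mem_ZhMinus hF)⟩
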